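/- Let $A,B$ be rings, ${}_AN_B$ and ${}_BM_A$ bimodules, and let $\Lambda=\Lambda_{(0,0)}=\begin{pmatrix}A&N\\M&B\end{pmatrix}$ be the Morita ring with zero bimodule maps, i.e. with multiplication $\begin{pmatrix}a&n\\m&b\end{pmatrix}\begin{pmatrix}a'&n'\\m'&b'\end{pmatrix}=\begin{pmatrix}aa'&an'+nb'\\ma'+bm'&bb'\end{pmatrix}$. Assume that $\Lambda$ is an Artin algebra, i.e. an algebra over a commutative artinian ring $R$ that is finitely generated as an $R$-module. Let $\mathsf Z_A\colon \mathrm{Mod}\,A\to\mathrm{Mod}\,\Lambda$ and $\mathsf Z_B\colon \mathrm{Mod}\,B\to\mathrm{Mod}\,\Lambda$ be the restriction functors along the ring surjections $\Lambda\to A$, $\begin{pmatrix}a&n\\m&b\end{pmatrix}\mapsto a$, and $\Lambda\to B$, $\begin{pmatrix}a&n\\m&b\end{pmatrix}\mapsto b$ (in terms of tuples, $\mathsf Z_A(X)=(X,0,0,0)$ and $\mathsf Z_B(Y)=(0,Y,0,0)$). Assume that $\mathsf Z_A$ and $\mathsf Z_B$ are homological embeddings on finitely generated modules: the induced maps $\mathrm{Ext}^n_A(X,X')\to\mathrm{Ext}^n_\Lambda(\mathsf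 Z_A(X),\mathsf Z_A(X'))$ and $\mathrm{Ext}^n_B(Y,Y')\to\mathrm{Ext}^n_\Lambda(\mathsf Z_B(Y),\mathsf Z_B(Y'))$ are isomorphisms for all $n\ge 0$, all finitely generated left $A$-modules $X,X'$ and all finitely generated left $B$-modules $Y,Y'$. For a ring $S$ let $\mathrm{silp}\,S$ be the supremum of the injective dimensions of the finitely generated projective left $S$-modules, and $\mathrm{spli}\,S$ the supremum of the projective dimensions of the finitely generated injective left $S$-modules. (i) Suppose that $M_A$ and $N_B$ are projective, $\mathrm{pd}\,{}_BM<\infty$ and $\mathrm{pd}\,{}_AN<\infty$. If $\mathrm{silp}\,A<\infty$ and $\mathrm{silp}\,B<\infty$, then $\mathrm{silp}\,\Lambda<\infty$. (ii) Suppose that ${}_BM$ and ${}_AN$ are projective, $\mathrm{pd}\,M_A<\infty$ and $\mathrm{pd}\,N_B<\infty$. If $\mathrm{spli}\,A<\infty$ and $\mathrm{spli}\,B<\infty$, then $\mathrm{spli}\,\Lambda<\infty$. -/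

import Mathlib

open CategoryTheory

universe u v w

/-- The Morita ring with zero bimodule maps, i.e. the ring of matrices
`(a n; m b)` with `a ∈ A`, `n ∈ N`, `m ∈ M`, `b ∈ B`, where `M` is a `B`-`A`-bimodule and `N` is an
`A`-`B`-bimodule. Addition is entrywise, and the multiplication is
`(a n; m b) * (a' n'; m' b') = (a a', a n' + n b'; m a' + b m', b b')`:
since both bimodule maps `M ⊗ N → B`, `N ⊗ M → A` are zero, the products `m n'` and `n m'`
do not contribute. -/
@[ext]
structure ZeroMoritaRing (A B M N : Type u) where
  a : A
  n : N
  m : M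
  b : B

namespace ZeroMoritaRing

variable {A B M N : Type u}

section AddCommGroup

variable [AddCommGroup A] [AddCommGroup B] [AddCommGroup M] [AddCommGroup N]

instance : Zero (ZeroMoritaRing A B M N) := ⟨⟨0, 0, 0, 0⟩⟩
instance : Add (ZeroMoritaRing A B M N) := ⟨fun x y => ⟨x.a + y.a, x.n + y.n, x.m + y.m, x.b + y.b⟩⟩
instance : Neg (ZeroMoritaRing A B M N) := ⟨fun x => ⟨-x.a, -x.n, -x.m, -x.b⟩⟩

@[simp] theorem zero_a : (0 : ZeroMoritaRing A B M N).a = 0 := rfl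
@[simp] theorem zero_n : (0 : ZeroMoritaRing A B M N).n = 0 := rfl
@[simp] theorem zero_m : (0 : ZeroMoritaRing A B M N).m = 0 := rfl
@[simp] theorem zero_b : (0 : ZeroMoritaRing A B M N).b = 0 := rfl
@[simp] theorem add_a (x y : ZeroMoritaRing A B M N) : (x + y).a = x.a + y.a := rfl
@[simp] theorem add_n (x y : ZeroMoritaRing A B M N) : (x + y).n = x.n + y.n := rfl
@[simp] theorem add_m (x y : ZeroMoritaRing A B M N) : (x + y).m = x.m + y.m := rfl
@[simp] theorem add_b (x y : ZeroMoritaRing A B M N) : (x + y).b = x.b + y.b := rfl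
@[simp] theorem neg_a (x : ZeroMoritaRing A B M N) : (-x).a = -x.a := rfl
@[simp] theorem neg_n (x : ZeroMoritaRing A B M N) : (-x).n = -x.n := rfl
@[simp] theorem neg_m (x : ZeroMoritaRing A B M N) : (-x).m = -x.m := rfl
@[simp] theorem neg_b (x : ZeroMoritaRing A B M N) : (-x).b = -x.b := rfl

instance : AddCommGroup (ZeroMoritaRing A B M N) where
  add_assoc x y z := by ext <;> simp [add_assoc]
  zero_add x := by ext <;> simp
  add_zero x := by ext <;> simp
  neg_add_cancel x := by ext <;> simp
  add_comm x y := by ext <;> simp [add_comm]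
  nsmul := nsmulRec
  zsmul := zsmulRec

end AddCommGroup

section Ring

variable [Ring A] [Ring B] [AddCommGroup M] [AddCommGroup N]

instance : One (ZeroMoritaRing A B M N) := ⟨⟨1, 0, 0, 1⟩⟩

@[simp] theorem one_a : (1 : ZeroMoritaRing A B M N).a = 1 := rfl
@[simp] theorem one_n : (1 : ZeroMoritaRing A B M N).n = 0 := rfl
@[simp] theorem one_m : (1 : ZeroMoritaRing A B M N).m = 0 := rfl
@[simp] theorem one_b : (1 : ZeroMoritaRing A B M N).b = 1 := rfl
/- Right modules are left modules over the opposite ring: `m a` is `MulOpposite.op a • m`. -/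
variable [Module B M] [Module Aᵐᵒᵖ M] [Module A N] [Module Bᵐᵒᵖ N]

instance : Mul (ZeroMoritaRing A B M N) := ⟨fun x y =>
  ⟨x.a * y.a, x.a • y.n + MulOpposite.op y.b • x.n,
   MulOpposite.op y.a • x.m + x.b • y.m, x.b * y.b⟩⟩

@[simp] theorem mul_a (x y : ZeroMoritaRing A B M N) : (x * y).a = x.a * y.a := rfl
@[simp] theorem mul_n (x y : ZeroMoritaRing A B M N) :
    (x * y).n = x.a • y.n + MulOpposite.op y.b • x.n := rfl
@[simp] theorem mul_m (x y : ZeroMoritaRing A B M N) :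
    (x * y).m = MulOpposite.op y.a • x.m + x.b • y.m := rfl
@[simp] theorem mul_b (x y : ZeroMoritaRing A B M N) : (x * y).b = x.b * y.b := rfl

variable [SMulCommClass B Aᵐᵒᵖ M] [SMulCommClass A Bᵐᵒᵖ N]

instance : Ring (ZeroMoritaRing A B M N) where
  __ := (inferInstance : AddCommGroup (ZeroMoritaRing A B M N))
  mul_assoc x y z := by
    ext <;> simp [mul_assoc, mul_smul, smul_add, add_assoc, smul_comm]
  one_mul x := by ext <;> simp
  mul_one x := by ext <;> simp
  left_distrib x y z := by ext <;> simp [mul_add, add_smul] <;> abel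
  right_distrib x y z := by ext <;> simp [add_mul, add_smul] <;> abel
  zero_mul x := by ext <;> simp
  mul_zero x := by ext <;> simp

variable (A B M N)

/-- The surjective ring homomorphism `(a n; m b) ↦ a`. -/
def projA : ZeroMoritaRing A B M N →+* A where
  toFun := ZeroMoritaRing.a
  map_one' := rfl
  map_mul' _ _ := rfl
  map_zero' := rfl
  map_add' _ _ := rfl

/-- The surjective ring homomorphism `(a n; m b) ↦ b`. -/
def projB : ZeroMoritaRing A B M N →+* B where
  toFun := ZeroMoritaRing.b
  map_one' := rfl
  map_mul' _ _ := rfl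
  map_zero' := rfl
  map_add' _ _ := rfl

/-- The functor `Z_A : Mod A ⥤ Mod Λ`, `X ↦ (X, 0, 0, 0)`: the tuple `(X, 0, 0, 0)` is the abelian
group `X ⊕ 0 = X` on which the matrix `(a n; m b)` acts by `x ↦ a x`. -/
noncomputable abbrev ZA : ModuleCat.{u} A ⥤ ModuleCat.{u} (ZeroMoritaRing A B M N) :=
  ModuleCat.restrictScalars (projA A B M N)

/-- The functor `Z_B : Mod B ⥤ Mod Λ`, `Y ↦ (0, Y, 0, 0)`: the matrix `(a n; m b)` acts on `Y` by
`y ↦ b y`. -/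
noncomputable abbrev ZB : ModuleCat.{u} B ⥤ ModuleCat.{u} (ZeroMoritaRing A B M N) :=
  ModuleCat.restrictScalars (projB A B M N)

end Ring

end ZeroMoritaRing

noncomputable instance restrictScalars_preservesFiniteLimits {R S : Type u} [Ring R] [Ring S] (f : S →+* R) :
    Limits.PreservesFiniteLimits (ModuleCat.restrictScalars.{u} f) where
  preservesFiniteLimits _ _ _ := ⟨inferInstance⟩

noncomputable instance restrictScalars_preservesFiniteColimits {R S : Type u} [Ring R] [Ring S] (f : S →+* R) :
    Limits.PreservesFiniteColimits (ModuleCat.restrictScalars.{u} f) where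
  preservesFiniteColimits _ _ _ := ⟨inferInstance⟩

/-- An exact functor `F : Mod R ⥤ Mod S` is a homological embedding on finitely generated modules if
the maps `Ext^n_R(X, Y) → Ext^n_S(F X, F Y)` induced by `F` are isomorphisms for all finitely
generated `R`-modules `X, Y` and all `n ≥ 0`. (This is implied by the same property for all `R`-modules
`X, Y`. Over a Noetherian ring, `Ext` between finitely generated modules may be computed
in the category of all modules.) -/
def IsHomologicalEmbedding {R S : Type u} [Ring R] [Ring S]
    (F : ModuleCat.{u} R ⥤ ModuleCat.{u} S) [F.Additive]
    [Limits.PreservesFiniteLimits F] [Limits.PreservesFiniteColimits F] : Prop :=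
  ∀ X Y : ModuleCat.{u} R, Module.Finite R X → Module.Finite R Y →
    ∀ n : ℕ, Function.Bijective (F.mapExtAddHom X Y n)

/-- `silp R` is the supremum of the injective dimensions of the finitely generated projective left
`R`-modules. -/
noncomputable def silp (R : Type u) [Ring R] : WithBot ℕ∞ :=
  ⨆ (P : ModuleCat.{u} R) (_ : Module.Finite R P) (_ : Projective P), injectiveDimension P

/-- `spli R` is the supremum of the projective dimensions of the finitely generated injective left
`R`-modules. -/
noncomputable def spli (R : Type u) [Ring R] : WithBot ℕ∞ :=
  ⨆ (I : ModuleCat.{u} R) (_ : Module.Finite R I) (_ : Injective I), projectiveDimension I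

/-!
Write `Λ` for the Morita ring, `Z_A` and `Z_B` for the restriction functors, and `id`, `pd` for
injective and projective dimension over the ring in question.

The two halves are dual to each other, and both are organised around the same ideas.

* `(ker p) (ker q) (ker p) = 0` for the surjections `p : Λ → A` and `q : Λ → B`, so a finitely
  generated `Λ`-module is an iterated extension of modules `Z_A X` and `Z_B Y`
  (`finite_restrictScalars_induction`). Bounds on `id` and `pd` by one can be tested on finitely
  generated modules, hence on the `Z_A X` and `Z_B Y`.
* There are exact sequences `0 → Z_A X → Coind X → Z_B Hom_A(N, X) → 0`, where the coinduced module
  `Coind X` is injective if `X` is (`ZeroMoritaRing.Coind.injective`), and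
  `0 → Z_A N → Column → Z_B B → 0`, where `Column`, the second column of `Λ`, is projective; and the
  same sequences with the two corners exchanged. They let one compute the mixed groups
  `Ext(Z_B Y, Z_A X)`, which the homological embeddings do not control, in terms of unmixed ones.
* For `I` injective over `A`, `id Hom_A(N, I) ≤ pd N_B` (`BimodHom.hasInjectiveDimensionLT`),
  because `Hom_A(N, I)` is a retract of a dual `Hom_ℤ(N, E)` with `E` divisible, and `Hom_ℤ(-, E)`
  turns projective right modules into injective left modules.
* Over an Artin algebra every finitely generated module embeds into a finitely generated injective
  module (`enoughFiniteInjectives`), since essential extensions of finitely generated modules are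
  finitely generated. So `spli < ∞` has content: it bounds `pd` of all finitely generated modules of
  finite `id`.

For the first half, if `N_B` is projective and `I` is a finitely generated injective `A`-module,
then `Hom_A(N, I)` is injective, and the first exact sequence gives `id Z_A I ≤ 1`; by induction
`id Z_A X ≤ id X + 1` for finitely generated `X`. Now `silp A < ∞` and `pd N < ∞` give `id N < ∞`, so
both ends of the second exact sequence have finite `id`. Thus the columns of `Λ`, hence `Λ` and all
finitely generated projectives, have bounded `id`.

For the second half, if `N` is projective over `A`, the second exact sequence gives `pd Z_B B ≤ 1`,
and by induction `pd Z_B Y ≤ pd Y + 1` for finitely generated `Y`. If `X` is a finitely generated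
injective `A`-module, then `Hom_A(N, X)` has finite `id`, hence bounded `pd` by `spli B < ∞`, and
the first exact sequence bounds `pd Coind X`. Every finitely generated `Λ`-module embeds into a
finite direct sum of such injective modules `Coind X`, by extension from the modules `Z_A X` and
`Z_B Y`; an injective one is a retract of it.
-/

section

open Abelian MulOpposite

/-! ### Homological dimensions and finitely generated modules -/

section Homological

variable {S : Type u} [Ring S]

theorem shortExact_ofHom {X Y Z : Type u} [AddCommGroup X] [Module S X] [AddCommGroup Y]
    [Module S Y] [AddCommGroup Z] [Module S Z] (f : X →ₗ[S] Y) (g : Y →ₗ[S] Z)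
    (hf : Function.Injective f) (hg : Function.Surjective g) (h : Function.Exact f g) :
    (ModuleCat.shortComplexOfCompEqZero f g h.linearMap_comp_eq_zero).ShortExact :=
  ModuleCat.shortComplex_shortExact _ h hf hg

theorem shortExact_mkQ {Y : Type u} [AddCommGroup Y] [Module S Y] (K : Submodule S Y) :
    (ModuleCat.shortComplexOfCompEqZero K.subtype K.mkQ
      (LinearMap.exact_subtype_mkQ K).linearMap_comp_eq_zero).ShortExact :=
  shortExact_ofHom _ _ K.subtype_injective K.mkQ_surjective
    (LinearMap.exact_subtype_mkQ K)

theorem shortExact_prod (X Y : Type u) [AddCommGroup X] [Module S X] [AddCommGroup Y]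
    [Module S Y] :
    (ModuleCat.shortComplexOfCompEqZero (LinearMap.inl S X Y) (LinearMap.snd S X Y)
      Function.Exact.inl_snd.linearMap_comp_eq_zero).ShortExact :=
  shortExact_ofHom _ _ LinearMap.inl_injective LinearMap.snd_surjective
    Function.Exact.inl_snd

/-- A retraction of modules, as a retract in the category of modules. -/
def retractOfLinearMap {X Y : Type u} [AddCommGroup X] [Module S X] [AddCommGroup Y]
    [Module S Y] (i : X →ₗ[S] Y) (r : Y →ₗ[S] X) (h : ∀ x, r (i x) = x) :
    Retract (ModuleCat.of S X) (ModuleCat.of S Y) where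
  i := ModuleCat.ofHom i
  r := ModuleCat.ofHom r
  retract := by ext x; exact h x

theorem exists_shortExact_finite_free [IsNoetherianRing S] (X : ModuleCat.{u} S)
    [Module.Finite S X] :
    ∃ C : ShortComplex (ModuleCat.{u} S), C.ShortExact ∧ C.X₃ = X ∧ Module.Finite S C.X₁ ∧
      Module.Finite S C.X₂ ∧ Projective C.X₂ := by
  obtain ⟨n, f, hf⟩ := Module.Finite.exists_fin' S X
  let g : (ULift.{u} (Fin n) → S) →ₗ[S] X :=
    f ∘ₗ (LinearEquiv.funCongrLeft S S (Equiv.ulift.symm)).toLinearMap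
  have hg : Function.Surjective g := hf.comp (LinearEquiv.surjective _)
  refine ⟨_, shortExact_ofHom (LinearMap.ker g).subtype g (Submodule.subtype_injective _) hg
    (LinearMap.exact_subtype_ker_map g), rfl, ?_, ?_, ?_⟩
  · exact inferInstanceAs (Module.Finite S (LinearMap.ker g))
  · exact inferInstanceAs (Module.Finite S (ULift.{u} (Fin n) → S))
  · exact (IsProjective.iff_projective _).1 inferInstance

/-- Ext groups into `W` in degree two, tested on finitely generated modules, detect injective
dimension at most one: for `0 → W → J → C → 0` with `J` injective, Baer's criterion for `C` only
involves `Ext¹(S ⧸ I, C) ≅ Ext²(S ⧸ I, W)`. -/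
theorem hasInjectiveDimensionLT_two_of_finite (W : ModuleCat.{u} S)
    (h : ∀ V : ModuleCat.{u} S, Module.Finite S V → Subsingleton (Ext V W 2)) :
    HasInjectiveDimensionLT W 2 := by
  obtain ⟨J, _, f, _⟩ := EnoughInjectives.presentation W
  have hS : (ShortComplex.mk _ _ (Limits.cokernel.condition f)).ShortExact :=
    { exact := ShortComplex.exact_cokernel f }
  suffices Injective (Limits.cokernel f) from
    (hS.hasInjectiveDimensionLT_X₃_iff 0 inferInstance).1
      (injective_iff_hasInjectiveDimensionLT_one.1 this)
  have hE (V : ModuleCat.{u} S) (hV : Module.Finite S V) (x : Ext V (Limits.cokernel f) 1) :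
      x = 0 := by
    have := h V hV
    obtain ⟨y, rfl⟩ := Ext.covariant_sequence_exact₃ V hS x (n₁ := 2) rfl
      (Subsingleton.elim _ _)
    rw [y.eq_zero_of_injective, Ext.zero_comp]
  refine (Module.injective_iff_injective_object S (Limits.cokernel f : ModuleCat.{u} S)).1
    (Module.Baer.injective fun I g => ?_)
  obtain ⟨φ, hφ⟩ := Ext.contravariant_sequence_exact₁ (shortExact_mkQ I) _
    (Ext.mk₀ (ModuleCat.ofHom g)) (n₁ := 1) rfl
    (hE (ModuleCat.of S (S ⧸ I)) (inferInstanceAs (Module.Finite S (S ⧸ I))) _)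
  obtain ⟨φ, rfl⟩ := Ext.homEquiv₀.symm.surjective φ
  rw [Ext.homEquiv₀_symm_apply, Ext.mk₀_comp_mk₀] at hφ
  have := Ext.homEquiv₀.symm.injective hφ
  exact ⟨φ.hom, fun x hx => congr($(this).hom ⟨x, hx⟩)⟩

/-- The dual of `hasInjectiveDimensionLT_two_of_finite`; here it is the splitting of a presentation
of the syzygy that only involves `Ext` into finitely generated modules. -/
theorem hasProjectiveDimensionLT_two_of_finite [IsNoetherianRing S] (W : ModuleCat.{u} S)
    [Module.Finite S W]
    (h : ∀ V : ModuleCat.{u} S, Module.Finite S V → Subsingleton (Ext W V 2)) :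
    HasProjectiveDimensionLT W 2 := by
  obtain ⟨C, hC, rfl, _, _, _⟩ := exists_shortExact_finite_free W
  suffices Projective C.X₁ from (hC.hasProjectiveDimensionLT_X₃_iff 0 inferInstance).2
      (projective_iff_hasProjectiveDimensionLT_one.1 this)
  have hE (V : ModuleCat.{u} S) (hV : Module.Finite S V) (x : Ext C.X₁ V 1) : x = 0 := by
    have := h V hV
    obtain ⟨y, rfl⟩ := Ext.contravariant_sequence_exact₁ hC V x (n₁ := 2) rfl
      (Subsingleton.elim _ _)
    rw [y.eq_zero_of_projective, Ext.comp_zero]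
  obtain ⟨D, hD, hX, _, _, _⟩ := exists_shortExact_finite_free C.X₁
  rw [← hX] at hE ⊢
  obtain ⟨φ, hφ⟩ := Ext.covariant_sequence_exact₃ _ hD (Ext.mk₀ (𝟙 D.X₃)) (n₁ := 1) rfl
    (hE _ inferInstance _)
  obtain ⟨φ, rfl⟩ := Ext.homEquiv₀.symm.surjective φ
  rw [Ext.homEquiv₀_symm_apply, Ext.mk₀_comp_mk₀] at hφ
  exact (Retract.mk φ D.g (Ext.homEquiv₀.symm.injective hφ)).projective

/-- To prove a property of the finitely generated modules of projective dimension `< k`, depending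
on `k`, it suffices to treat projectives and to go from the kernel of a finitely generated
projective presentation to the module. -/
theorem finite_projectiveDimension_induction [IsNoetherianRing S]
    {P : ℕ → ModuleCat.{u} S → Prop}
    (proj : ∀ F : ModuleCat.{u} S, Module.Finite S F → Projective F → P 1 F)
    (step : ∀ (k : ℕ) (C : ShortComplex (ModuleCat.{u} S)), C.ShortExact →
      Module.Finite S C.X₂ → Projective C.X₂ → P (k + 1) C.X₁ → P (k + 2) C.X₃)
    (k : ℕ) (X : ModuleCat.{u} S) (hX : Module.Finite S X)
    (h : HasProjectiveDimensionLT X (k + 1)) : P (k + 1) X := by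
  induction k generalizing X with
  | zero => exact proj X hX (projective_iff_hasProjectiveDimensionLT_one.2 h)
  | succ k ih =>
    obtain ⟨C, hC, rfl, h₁, h₂, h₃⟩ := exists_shortExact_finite_free X
    exact step k C hC h₂ h₃ (ih _ h₁ ((hC.hasProjectiveDimensionLT_X₃_iff k h₃).1 h))

variable (S) in
/-- Every finitely generated module embeds into a finitely generated injective module. -/
def EnoughFiniteInjectives : Prop :=
  ∀ X : ModuleCat.{u} S, Module.Finite S X →
    ∃ (I : ModuleCat.{u} S) (f : X ⟶ I), Module.Finite S I ∧ Injective I ∧ Mono f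

/-- The dual of `finite_projectiveDimension_induction`, for injective dimension. -/
theorem finite_injectiveDimension_induction (hS : EnoughFiniteInjectives S)
    {P : ℕ → ModuleCat.{u} S → Prop}
    (inj : ∀ I : ModuleCat.{u} S, Module.Finite S I → Injective I → P 1 I)
    (step : ∀ (k : ℕ) (C : ShortComplex (ModuleCat.{u} S)), C.ShortExact →
      Module.Finite S C.X₂ → Injective C.X₂ → P (k + 1) C.X₃ → P (k + 2) C.X₁)
    (k : ℕ) (X : ModuleCat.{u} S) (hX : Module.Finite S X)
    (h : HasInjectiveDimensionLT X (k + 1)) : P (k + 1) X := by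
  induction k generalizing X with
  | zero => exact inj X hX (injective_iff_hasInjectiveDimensionLT_one.2 h)
  | succ k ih =>
    obtain ⟨I, f, h₂, h₃, hf⟩ := hS X hX
    have hC : (ShortComplex.mk _ _ (Limits.cokernel.condition f)).ShortExact :=
      { exact := ShortComplex.exact_cokernel f }
    have : Module.Finite S (Limits.cokernel f : ModuleCat.{u} S) :=
      Module.Finite.of_surjective (Limits.cokernel.π f).hom
        ((ModuleCat.epi_iff_surjective _).1 inferInstance)
    exact step k _ hC h₂ h₃ (ih _ this ((hC.hasInjectiveDimensionLT_X₃_iff k h₃).2 h))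

/-- A property closed under extensions and retracts that holds for the regular module holds for all
finitely generated projective modules. -/
theorem finite_projective_induction {P : ModuleCat.{u} S → Prop}
    (retract : ∀ {X Y : ModuleCat.{u} S}, Retract X Y → P Y → P X)
    (ext : ∀ C : ShortComplex (ModuleCat.{u} S), C.ShortExact → P C.X₁ → P C.X₃ → P C.X₂)
    (self : P (ModuleCat.of S S)) (F : ModuleCat.{u} S) [Module.Finite S F] [Projective F] :
    P F := by
  have hfree (n : ℕ) : P (ModuleCat.of S (Fin n → S)) := by
    induction n with
    | zero => exact retract (retractOfLinearMap 0 0 fun x => Subsingleton.elim _ _) self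
    | succ n ih =>
      have := ext _ (shortExact_prod (S := S) S (Fin n → S)) self ih
      exact retract (retractOfLinearMap (Fin.consLinearEquiv S fun _ => S).symm.toLinearMap
        (Fin.consLinearEquiv S fun _ => S).toLinearMap fun x =>
          (Fin.consLinearEquiv S fun _ => S).apply_symm_apply x) this
  obtain ⟨n, f, hf⟩ := Module.Finite.exists_fin' S F
  have : Module.Projective S F := (IsProjective.iff_projective (F : Type u)).2 ‹_›
  obtain ⟨s, hs⟩ := Module.projective_lifting_property f LinearMap.id hf
  exact retract (retractOfLinearMap s f fun x => congr($hs x)) (hfree n)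

end Homological

/-! ### Injective hulls -/

section Hull

variable {S : Type u} [Ring S]

theorem exists_maximal_disjoint {Q : Type v} [AddCommGroup Q] [Module S Q] (E : Submodule S Q) :
    ∃ K : Submodule S Q, Disjoint K E ∧ ∀ K', K ≤ K' → Disjoint K' E → K' = K := by
  obtain ⟨K, -, hK⟩ := zorn_le_nonempty₀ {K : Submodule S Q | Disjoint K E} (fun c hc hcc y hy =>
    ⟨sSup c, by
      rw [Set.mem_ofPred_eq, Submodule.disjoint_def]
      intro x hx hxE
      obtain ⟨K, hK, hxK⟩ := (Submodule.mem_sSup_of_directed ⟨y, hy⟩ hcc.directedOn).1 hx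
      exact Submodule.disjoint_def.1 (hc hK) x hxK hxE, fun z hz => le_sSup hz⟩) ⊥ disjoint_bot_left
  exact ⟨K, hK.1, fun K' h h' => le_antisymm (hK.2 h' h) h⟩

/-- Existence of injective hulls: a submodule `V` of an injective module has an essential extension
inside it that is injective. It is found as a maximal essential extension `E`. If `K` is a maximal
submodule disjoint from `E`, the inclusion `E → Q` extends to an endomorphism `ψ` of `Q` that kills
`K`; its range is again essential over `V`, so that `ψ` is a retraction onto `E`. -/
theorem exists_essential_injective {Q : Type v} [AddCommGroup Q] [Module S Q] [Small.{v} S]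
    [Module.Injective S Q] (V : Submodule S Q) :
    ∃ E : Submodule S Q, V ≤ E ∧ (∀ D ≤ E, Disjoint D V → D = ⊥) ∧ Module.Injective S E := by
  obtain ⟨E, hVE, hE⟩ := zorn_le_nonempty₀
    {E : Submodule S Q | V ≤ E ∧ ∀ D ≤ E, Disjoint D V → D = ⊥} (fun c hc hcc y hy =>
      ⟨sSup c, ⟨(hc hy).1.trans (le_sSup hy), fun D hD hDV => by
        rw [eq_bot_iff]
        intro x hx
        obtain ⟨E, hE, hxE⟩ := (Submodule.mem_sSup_of_directed ⟨y, hy⟩ hcc.directedOn).1 (hD hx)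
        rw [← (hc hE).2 (D ⊓ E) inf_le_right (hDV.mono_left inf_le_left)]
        exact ⟨hx, hxE⟩⟩, fun z hz => le_sSup hz⟩) V
      ⟨le_rfl, fun D hD hDV => hDV.eq_bot_of_le hD⟩
  have hess := hE.1.2
  obtain ⟨K, hKE, hK⟩ := exists_maximal_disjoint E
  have hinj : Function.Injective (K.mkQ ∘ₗ E.subtype) := by
    rw [← LinearMap.ker_eq_bot, LinearMap.ker_comp, Submodule.ker_mkQ, eq_bot_iff]
    intro x hx
    exact Subtype.ext (Submodule.disjoint_def.1 hKE x hx x.2)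
  obtain ⟨φ, hφ⟩ := Module.Injective.extension_property S Q E (Q ⧸ K) _ hinj E.subtype
  set ψ : Q →ₗ[S] Q := φ ∘ₗ K.mkQ
  have hψE (x : Q) (hx : x ∈ E) : ψ x = x := congr($hφ ⟨x, hx⟩)
  have hψK (x : Q) (hx : x ∈ K) : ψ x = 0 := by
    simp [ψ, (Submodule.Quotient.mk_eq_zero K).2 hx]
  have hER : E ≤ LinearMap.range ψ := fun x hx => ⟨x, hψE x hx⟩
  have hR : LinearMap.range ψ ≤ E := by
    refine hE.2 ⟨hVE.trans hER, fun D hD hDV => ?_⟩ hER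
    have hDE : D ⊓ E = ⊥ := hess _ inf_le_right (hDV.mono_left inf_le_left)
    have : D.comap ψ = K := by
      refine hK _ (fun x hx => ?_) (Submodule.disjoint_def.2 fun x hx hxE => ?_)
      · simp [hψK x hx]
      · rw [Submodule.mem_comap, hψE x hxE] at hx
        exact hDE.le ⟨hx, hxE⟩
    rw [eq_bot_iff]
    intro x hx
    obtain ⟨y, rfl⟩ := hD hx
    exact hψK y (this.le hx)
  refine ⟨E, hVE, hess, Module.Baer.injective fun I g => ?_⟩
  obtain ⟨g', hg'⟩ := Module.Baer.of_injective ‹Module.Injective S Q› I (E.subtype ∘ₗ g)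
  refine ⟨ψ.codRestrict E (fun x => hR ⟨x, rfl⟩) ∘ₗ g', fun x hx => Subtype.ext ?_⟩
  simpa [hg' x hx] using hψE _ (g ⟨x, hx⟩).2

end Hull

/-! ### Finitely generated injective modules over Artin algebras -/

section Artin

variable {R : Type w} [CommRing R] {S : Type u} [Ring S] [Algebra R S]

/-- If the Jacobson radical of a semiprimary ring kills `D`, then `D` is contained in every
submodule over which the ambient module is essential, because `D` is semisimple. -/
theorem le_of_jacobson_smul_eq_zero [IsSemiprimaryRing S] {E : Type v} [AddCommGroup E]
    [Module S E] (V D : Submodule S E) (hV : ∀ D : Submodule S E, Disjoint D V → D = ⊥)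
    (hD : ∀ j ∈ Ring.jacobson S, ∀ x ∈ D, j • x = 0) : D ≤ V := by
  have htors : Module.IsTorsionBySet S D (Ring.jacobson S : Set S) := fun x j =>
    Subtype.ext (hD j j.2 x x.2)
  let := htors.module
  have : IsSemisimpleModule S D := htors.isSemisimpleModule_iff.1 inferInstance
  obtain ⟨C, hC⟩ := exists_isCompl (V.comap D.subtype)
  have hC0 : C = ⊥ := by
    refine Submodule.map_injective_of_injective D.subtype_injective
      ((hV _ (Submodule.disjoint_def.2 ?_)).trans (Submodule.map_bot _).symm)
    rintro _ ⟨x, hx, rfl⟩ hxV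
    exact congrArg D.subtype (Submodule.disjoint_def.1 hC.disjoint x hxV hx)
  have htop : V.comap D.subtype = ⊤ := by simpa [hC0] using hC.sup_eq_top
  intro x hx
  exact htop.ge (x := ⟨x, hx⟩) trivial

/-- Essential extensions of finitely generated modules over an Artin algebra are finitely generated.
With `J` the Jacobson radical, multiplication by generators of `J` embeds, modulo the part killed
by `J`, the elements killed by `J ^ (k + 1)` into a power of the module of those killed by
`J ^ k`; and the part killed by `J` lies in the submodule. -/
theorem finite_of_essential [IsArtinianRing R] [Module.Finite R S] {E : Type v} [AddCommGroup E]
    [Module S E] (V : Submodule S E) [Module.Finite S V]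
    (hV : ∀ D : Submodule S E, Disjoint D V → D = ⊥) : Module.Finite S E := by
  let : Module R E := Module.compHom E (algebraMap R S)
  have : IsScalarTower R S E := ⟨fun r s x => by
    rw [Algebra.smul_def, mul_smul]; rfl⟩
  have : IsArtinianRing S := isArtinian_of_tower R inferInstance
  let J := Ring.jacobson S
  -- `F k` consists of the elements killed by `J ^ k`, and `E = F (n + 1)` for large `n`
  let F (k : ℕ) : Submodule R E :=
    { carrier := {x | ∀ j ∈ J ^ k, j • x = 0}
      zero_mem' := by simp
      add_mem' := fun hx hy j hj => by rw [smul_add, hx j hj, hy j hj, add_zero]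
      smul_mem' := fun r x hx j hj => by rw [smul_comm, hx j hj, smul_zero] }
  have hF1 (x) (hx : x ∈ F 1) : x ∈ V := by
    have hD := le_of_jacobson_smul_eq_zero V
      { carrier := {x | ∀ j ∈ J, j • x = 0}
        zero_mem' := by simp
        add_mem' := fun hx hy j hj => by rw [smul_add, hx j hj, hy j hj, add_zero]
        smul_mem' := fun s x hx j hj => by
          rw [← mul_smul]; exact hx _ (Ideal.mul_mem_right s J hj) } hV (fun j hj x hx => hx j hj)
    refine hD fun j hj => hx j ?_
    rwa [Submodule.pow_one]
  have : Module.Finite R V := Module.Finite.trans S V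
  have hnV : IsNoetherian R (V.restrictScalars R) := inferInstanceAs (IsNoetherian R V)
  have hn1 : IsNoetherian R (F 1) := isNoetherian_of_injective
    ((F 1).subtype.codRestrict (V.restrictScalars R) fun x => hF1 x x.2)
    ((LinearMap.injective_codRestrict_iff _).2 (F 1).subtype_injective)
  obtain ⟨r, j, hj⟩ := Submodule.fg_iff_exists_fin_generating_family.1
    (IsNoetherian.noetherian (J : Submodule S S))
  have hjJ (i : Fin r) : j i ∈ J := hj.le (Submodule.subset_span ⟨i, rfl⟩)
  have hF (k : ℕ) : IsNoetherian R (F (k + 1)) := by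
    induction k with
    | zero => exact hn1
    | succ k ih =>
      let g : F (k + 2) →ₗ[R] (Fin r → F (k + 1)) := LinearMap.pi fun i =>
        ((DistribSMul.toLinearMap R E (j i)).comp (F (k + 2)).subtype).codRestrict _
          fun x j' hj' => by
            change j' • j i • (x : E) = 0
            rw [← mul_smul]
            exact x.2 _ (by rw [Submodule.pow_succ]; exact Submodule.mul_mem_mul hj' (hjJ i))
      have hker (x : F (k + 2)) (hx : g x = 0) : (x : E) ∈ F 1 := by
        have hle : (J : Submodule S S) ≤ LinearMap.ker (LinearMap.toSpanSingleton S E x) := by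
          rw [← hj, Submodule.span_le]
          rintro _ ⟨i, rfl⟩
          exact congrArg Subtype.val (congrFun hx i)
        intro y hy
        exact hle ((Submodule.pow_one J).le hy)
      have : IsNoetherian R (LinearMap.ker g) := isNoetherian_of_injective
        (((F (k + 2)).subtype.comp (LinearMap.ker g).subtype).codRestrict (F 1)
          fun x => hker x x.2) ((LinearMap.injective_codRestrict_iff _).2
            ((F (k + 2)).subtype_injective.comp (LinearMap.ker g).subtype_injective))
      exact isNoetherian_of_range_eq_ker (LinearMap.ker g).subtype g (by simp)
  obtain ⟨n, hn⟩ := IsSemiprimaryRing.isNilpotent (R := S)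
  have htop : F (n + 1) = ⊤ := by
    refine eq_top_iff.2 fun x _ y hy => ?_
    have : J ^ n = 0 := hn
    rw [Submodule.pow_succ, this, Submodule.zero_eq_bot, Submodule.bot_mul] at hy
    rw [(Submodule.mem_bot S).1 hy, zero_smul]
  have : Module.Finite R E := by
    have := hF n
    rw [htop] at this
    exact Module.Finite.equiv (Submodule.topEquiv (R := R) (M := E))
  exact Module.Finite.of_restrictScalars_finite R S E

variable (R S) in
/-- An injective hull of a finitely generated module over an Artin algebra is finitely generated. -/
theorem enoughFiniteInjectives [IsArtinianRing R] [Module.Finite R S] :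
    EnoughFiniteInjectives S := by
  intro X hX
  obtain ⟨Q, hQ, f, hf⟩ := EnoughInjectives.presentation X
  have : Module.Injective S Q := (Module.injective_iff_injective_object S Q).2 hQ
  obtain ⟨E, hVE, hE, hinj⟩ := exists_essential_injective (LinearMap.range f.hom)
  have hfin : Module.Finite S E := by
    let V : Submodule S E := (LinearMap.range f.hom).comap E.subtype
    have : Module.Finite S V :=
      Module.Finite.equiv (Submodule.comapSubtypeEquivOfLe hVE).symm
    refine finite_of_essential (R := R) V fun D hD => ?_
    refine Submodule.map_injective_of_injective E.subtype_injective
      ((hE _ (Submodule.map_subtype_le E D) (Submodule.disjoint_def.2 ?_)).trans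
        (Submodule.map_bot _).symm)
    rintro _ ⟨x, hx, rfl⟩ hxV
    exact congrArg E.subtype (Submodule.disjoint_def.1 hD x hx hxV)
  refine ⟨ModuleCat.of S E, ModuleCat.ofHom (f.hom.codRestrict E fun x => hVE ⟨x, rfl⟩), hfin,
    (Module.injective_iff_injective_object S E).1 hinj, ?_⟩
  rw [ModuleCat.mono_iff_injective] at hf ⊢
  exact fun x y h => hf (congrArg Subtype.val h)

end Artin

/-! ### Filtering modules by restrictions along two surjections -/

section Restriction

variable {L A B : Type u} [Ring L] [Ring A] [Ring B]

/-- A module killed by the kernel of a surjection is restricted along it. -/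
theorem exists_restrictScalars_iso (p : L →+* A) (hp : Function.Surjective p)
    (W : ModuleCat.{u} L) [Module.Finite L W] (hW : ∀ x ∈ RingHom.ker p, ∀ w : W, x • w = 0) :
    ∃ X : ModuleCat.{u} A, Module.Finite A X ∧
      Nonempty ((ModuleCat.restrictScalars p).obj X ≅ W) := by
  let _ : SMul A W := ⟨fun a w => Function.surjInv hp a • w⟩
  have hs (x : L) (w : W) : p x • w = x • w := by
    change Function.surjInv hp (p x) • w = x • w
    rw [← sub_eq_zero, ← sub_smul]
    refine hW _ ?_ w
    rw [RingHom.mem_ker, map_sub, Function.surjInv_eq hp, sub_self]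
  let _ : Module A W := hp.moduleLeft p hs
  have : RingHomSurjective p := ⟨hp⟩
  let f : W →ₛₗ[p] W := { AddMonoidHom.id W with map_smul' := fun x w => (hs x w).symm }
  let g : ((ModuleCat.restrictScalars p).obj (ModuleCat.of A W)) ≃ₗ[L] W :=
    { AddEquiv.refl W with map_smul' := fun x w => hs x w }
  exact ⟨ModuleCat.of A W, Module.Finite.of_surjective f Function.surjective_id, ⟨g.toModuleIso⟩⟩

/-- If the product `(ker p) (ker q) (ker p)` vanishes for surjections `p : L → A` and `q : L → B`,
then every finitely generated `L`-module is an iterated extension of finitely generated modules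
restricted from `A` or `B`. -/
theorem finite_restrictScalars_induction [IsNoetherianRing L] (p : L →+* A) (q : L →+* B)
    (hp : Function.Surjective p) (hq : Function.Surjective q)
    (hpq : ∀ x ∈ RingHom.ker p, ∀ y ∈ RingHom.ker q, ∀ z ∈ RingHom.ker p, x * y * z = 0)
    {P : ModuleCat.{u} L → Prop} (iso : ∀ {X Y : ModuleCat.{u} L}, (X ≅ Y) → P X → P Y)
    (ext : ∀ C : ShortComplex (ModuleCat.{u} L), C.ShortExact → P C.X₁ → P C.X₃ → P C.X₂)
    (hA : ∀ X : ModuleCat.{u} A, Module.Finite A X → P ((ModuleCat.restrictScalars p).obj X))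
    (hB : ∀ Y : ModuleCat.{u} B, Module.Finite B Y → P ((ModuleCat.restrictScalars q).obj Y))
    (W : ModuleCat.{u} L) [Module.Finite L W] : P W := by
  have killA (V : ModuleCat.{u} L) (_ : Module.Finite L V)
      (hV : ∀ x ∈ RingHom.ker p, ∀ w : V, x • w = 0) : P V := by
    obtain ⟨X, hX, ⟨i⟩⟩ := exists_restrictScalars_iso p hp V hV
    exact iso i (hA X hX)
  have killB (V : ModuleCat.{u} L) (_ : Module.Finite L V)
      (hV : ∀ x ∈ RingHom.ker q, ∀ w : V, x • w = 0) : P V := by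
    obtain ⟨X, hX, ⟨i⟩⟩ := exists_restrictScalars_iso q hq V hV
    exact iso i (hB X hX)
  -- the filtration `W ⊇ (ker p) W ⊇ (ker q) (ker p) W ⊇ (ker p) (ker q) (ker p) W = 0`
  let W₁ : Submodule L W := RingHom.ker p • ⊤
  let W₂ : Submodule L W₁ := RingHom.ker q • ⊤
  refine ext _ (shortExact_mkQ W₁) (ext _ (shortExact_mkQ W₂) ?_ ?_) ?_
  · refine killA _ (inferInstanceAs (Module.Finite L W₂)) ?_
    rintro x hx ⟨w, hw⟩
    refine Subtype.ext ?_
    change x • w = 0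
    refine Submodule.smul_induction_on hw (fun y hy w₁ _ => Subtype.ext ?_) fun a b ha hb => by
      rw [smul_add, ha, hb, add_zero]
    obtain ⟨w₁, hw₁⟩ := w₁
    change x • y • w₁ = 0
    refine Submodule.smul_induction_on hw₁ (fun z hz w _ => ?_) fun a b ha hb => by
      rw [smul_add, smul_add, ha, hb, add_zero]
    rw [← mul_smul, ← mul_smul, hpq x hx y hy z hz, zero_smul]
  · refine killB _ (inferInstanceAs (Module.Finite L (W₁ ⧸ W₂))) fun x hx w => ?_
    obtain ⟨w, rfl⟩ := W₂.mkQ_surjective w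
    exact (Submodule.Quotient.mk_eq_zero W₂).2 (Submodule.smul_mem_smul hx trivial)
  · refine killA _ (inferInstanceAs (Module.Finite L (W ⧸ W₁))) fun x hx w => ?_
    obtain ⟨w, rfl⟩ := W₁.mkQ_surjective w
    exact (Submodule.Quotient.mk_eq_zero W₁).2 (Submodule.smul_mem_smul hx trivial)

end Restriction

/-! ### Modules of homomorphisms out of a bimodule -/

section BimodHom

/-- The `A`-linear maps `N → X` from an `A`-`B`-bimodule `N`, as a left `B`-module: `b • φ` is
`n ↦ φ (n b)`. -/
def BimodHom (A N X : Type*) [Ring A] [AddCommGroup N] [Module A N] [AddCommGroup X] [Module A X] :=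
  N →ₗ[A] X

namespace BimodHom

variable {A B N X : Type*} [Ring A] [Ring B] [AddCommGroup N] [Module A N] [AddCommGroup X]
  [Module A X]

instance : AddCommGroup (BimodHom A N X) := inferInstanceAs (AddCommGroup (N →ₗ[A] X))
instance : FunLike (BimodHom A N X) N X := inferInstanceAs (FunLike (N →ₗ[A] X) N X)
instance : LinearMapClass (BimodHom A N X) A N X :=
  inferInstanceAs (LinearMapClass (N →ₗ[A] X) A N X)

/-- A linear map, regarded as an element of `BimodHom`. -/
def of (f : N →ₗ[A] X) : BimodHom A N X := f

/-- The linear map underlying an element of `BimodHom`. -/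
def hom (φ : BimodHom A N X) : N →ₗ[A] X := φ


@[simp] theorem zero_apply (n : N) : (0 : BimodHom A N X) n = 0 := rfl
@[simp] theorem add_apply (φ ψ : BimodHom A N X) (n : N) : (φ + ψ) n = φ n + ψ n := rfl

@[ext] theorem ext {φ ψ : BimodHom A N X} (h : ∀ n, φ n = ψ n) : φ = ψ := DFunLike.ext _ _ h

variable [Module Bᵐᵒᵖ N] [SMulCommClass A Bᵐᵒᵖ N]

instance : SMul B (BimodHom A N X) :=
  ⟨fun b φ => of
    { toFun := fun n => φ (op b • n)
      map_add' := fun m n => by rw [smul_add, map_add]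
      map_smul' := fun a n => by rw [← smul_comm, map_smul, RingHom.id_apply] }⟩

@[simp] theorem smul_apply (b : B) (φ : BimodHom A N X) (n : N) : (b • φ) n = φ (op b • n) := rfl

instance : Module B (BimodHom A N X) where
  one_smul φ := by ext; simp
  mul_smul b c φ := by ext n; simp [mul_smul]
  smul_zero b := by ext; simp
  smul_add b φ ψ := by ext; simp
  add_smul b c φ := by ext n; simp [add_smul]
  zero_smul φ := by ext n; simp

/-- Duals `Hom_ℤ(N, E)` of projective right `B`-modules `N` into divisible groups `E` are injective
left `B`-modules. -/
theorem injective_int {B N E : Type u} [Ring B] [AddCommGroup N] [Module Bᵐᵒᵖ N]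
    [AddCommGroup E] [Module.Injective ℤ E] [Module.Projective Bᵐᵒᵖ N] :
    Module.Injective B (BimodHom ℤ N E) := by
  -- For each generator `n` of the free cover, extend the additive map `x ↦ g x n` to `G n : B → E`,
  -- and glue the `G n` along a section `s` of the free cover.
  obtain ⟨s, hs⟩ := Module.projective_def'.1 ‹Module.Projective Bᵐᵒᵖ N›
  refine Module.Baer.injective fun I g => ?_
  have hE (n : N) : ∃ G : B →ₗ[ℤ] E, ∀ x : I, G x = g x n := by
    let f : I →+ E :=
      { toFun := fun x => g x n
        map_zero' := by simp
        map_add' := by simp }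
    obtain ⟨G, hG⟩ := Module.Injective.extension_property ℤ E I B
      I.subtype.toAddMonoidHom.toIntLinearMap I.subtype_injective f.toIntLinearMap
    exact ⟨G, fun x => congr($hG x)⟩
  choose G hG using hE
  let h : N →+ E := (Finsupp.liftAddHom fun n : N =>
    (G n).toAddMonoidHom.comp (opAddEquiv (α := B)).symm.toAddMonoidHom).comp s.toAddMonoidHom
  have hh (n : N) : h n = (s n).sum fun m b => G m (unop b) := rfl
  refine ⟨LinearMap.toSpanSingleton B (BimodHom ℤ N E) (of h.toIntLinearMap), fun x hx => ?_⟩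
  ext n
  change h (op x • n) = _
  rw [hh, map_smul, Finsupp.sum_smul_index' (by simp)]
  have key (m : N) (b : Bᵐᵒᵖ) : G m (unop (op x • b)) = g ⟨x, hx⟩ (b • m) := by
    have : unop (op x • b) = ((unop b • (⟨x, hx⟩ : I) : I) : B) := rfl
    rw [this, hG, map_smul]
    rfl
  simp_rw [key]
  conv_rhs => rw [← show Finsupp.linearCombination Bᵐᵒᵖ id (s n) = n from congr($hs n),
    Finsupp.linearCombination_apply, map_finsuppSum]
  rfl

/-- Dualizing into a divisible group turns projective dimension on the right into injective
dimension on the left. -/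
theorem hasInjectiveDimensionLT_int {B E : Type u} [Ring B] [AddCommGroup E]
    [Module.Injective ℤ E] (k : ℕ) (N : ModuleCat.{u} Bᵐᵒᵖ)
    (h : HasProjectiveDimensionLT N (k + 1)) :
    HasInjectiveDimensionLT (ModuleCat.of B (BimodHom ℤ N E)) (k + 1) := by
  induction k generalizing N with
  | zero =>
    have : Module.Projective Bᵐᵒᵖ N := (IsProjective.iff_projective (N : Type u)).2
      (projective_iff_hasProjectiveDimensionLT_one.2 h)
    rw [zero_add, ← injective_iff_hasInjectiveDimensionLT_one,
      ← Module.injective_iff_injective_object]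
    exact injective_int
  | succ k ih =>
    have hC := ModuleCat.shortExact_projectiveShortComplex N
    set C := N.projectiveShortComplex
    have hP : Projective C.X₂ := (IsProjective.iff_projective (C.X₂ : Type u)).1 inferInstance
    have h₁ := ih C.X₁ ((hC.hasProjectiveDimensionLT_X₃_iff k hP).1 h)
    have h₂ : Injective (ModuleCat.of B (BimodHom ℤ C.X₂ E)) := by
      rw [← Module.injective_iff_injective_object]
      have : Module.Projective Bᵐᵒᵖ C.X₂ := (IsProjective.iff_projective (C.X₂ : Type u)).2 hP
      exact injective_int
    let pre {U V : ModuleCat.{u} Bᵐᵒᵖ} (f : U ⟶ V) : BimodHom ℤ V E →ₗ[B] BimodHom ℤ U E :=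
      { toFun := fun φ => of (φ.hom ∘ₗ f.hom.toAddMonoidHom.toIntLinearMap)
        map_add' := fun φ ψ => rfl
        map_smul' := fun b φ => by
          ext n
          change φ (op b • f.hom n) = φ (f.hom (op b • n))
          exact congrArg φ (map_smul f.hom (op b) n).symm }
    have hg : Function.Surjective C.g := (ModuleCat.epi_iff_surjective _).1 hC.epi_g
    have hf : Function.Injective C.f := (ModuleCat.mono_iff_injective _).1 hC.mono_f
    have hfg : Function.Exact C.f C.g :=
      (ShortComplex.ShortExact.moduleCat_exact_iff_function_exact C).1 hC.exact
    have hD := shortExact_ofHom (pre C.g) (pre C.f) (fun φ ψ hφ => by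
        ext n
        obtain ⟨m, rfl⟩ := hg n
        exact congr($hφ m)) (fun φ => by
        obtain ⟨ψ, hψ⟩ := Module.Injective.extension_property ℤ E C.X₁ C.X₂
          C.f.hom.toAddMonoidHom.toIntLinearMap hf φ
        exact ⟨of ψ, ext fun n => congr($hψ n)⟩) (fun φ => by
        constructor
        · intro hφ
          let ψ : C.X₂ →ₗ[ℤ] E := φ.hom
          have hker : ∀ x ∈ LinearMap.ker C.g.hom.toAddMonoidHom.toIntLinearMap, ψ x = 0 := by
            intro x hx
            obtain ⟨y, rfl⟩ := (hfg x).1 hx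
            exact congr($hφ y)
          let r := Function.surjInv hg
          have hr (x) : ψ (r (C.g x)) = ψ x := by
            rw [← sub_eq_zero, ← map_sub]
            refine hker _ ?_
            change C.g.hom (r (C.g x) - x) = 0
            rw [map_sub]
            exact sub_eq_zero.2 (Function.surjInv_eq hg _)
          refine ⟨of <| AddMonoidHom.toIntLinearMap
            { toFun := fun n => ψ (r n)
              map_zero' := by
                have := hr 0
                rwa [map_zero, map_zero] at this
              map_add' := fun a b => by
                obtain ⟨a, rfl⟩ := hg a
                obtain ⟨b, rfl⟩ := hg b
                rw [← map_add, hr, hr, hr, map_add] }, ext fun n => hr n⟩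
        · rintro ⟨ψ, rfl⟩
          ext n
          have : C.g (C.f n) = 0 := hfg.apply_apply_eq_zero n
          change ψ (C.g (C.f n)) = 0
          rw [this, map_zero])
    exact (hD.hasInjectiveDimensionLT_X₃_iff k h₂).1 h₁

theorem exists_injective_int (X : Type u) [AddCommGroup X] :
    ∃ (E : Type u) (_ : AddCommGroup E) (_ : Module.Injective ℤ E) (j : X →ₗ[ℤ] E),
      Function.Injective j := by
  obtain ⟨E, hE, j, hj⟩ := EnoughInjectives.presentation (ModuleCat.of ℤ X)
  have hE : Module.Injective ℤ E := (Module.injective_iff_injective_object ℤ E).2 hE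
  rw [Subsingleton.elim E.isModule (AddCommGroup.toIntModule E)] at hE
  exact ⟨E, inferInstance, hE, j.hom.toAddMonoidHom.toIntLinearMap,
    (ModuleCat.mono_iff_injective j).1 hj⟩

/-- For an injective `A`-module `I`, the injective dimension of `Hom_A(N, I)` is bounded by the
projective dimension of the right module `N`: embed `I` into an injective abelian group `E`; then
`I` is an `A`-linear retract of `Hom_ℤ(A, E)`, hence `Hom_A(N, I)` is one of `Hom_A(N, Hom_ℤ(A, E))
= Hom_ℤ(N, E)`. -/
theorem hasInjectiveDimensionLT {A B N I : Type u} [Ring A] [Ring B] [AddCommGroup N]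
    [Module A N] [Module Bᵐᵒᵖ N] [SMulCommClass A Bᵐᵒᵖ N] [AddCommGroup I] [Module A I]
    [Module.Injective A I] (k : ℕ)
    (h : HasProjectiveDimensionLT (ModuleCat.of Bᵐᵒᵖ N) (k + 1)) :
    HasInjectiveDimensionLT (ModuleCat.of B (BimodHom A N I)) (k + 1) := by
  obtain ⟨E, _, _, j, hj⟩ := exists_injective_int I
  let i : I →ₗ[A] BimodHom ℤ A E :=
    { toFun := fun x => of
        (j ∘ₗ (LinearMap.toSpanSingleton A I x).toAddMonoidHom.toIntLinearMap)
      map_add' := fun x y => by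
        ext a
        change j (a • (x + y)) = j (a • x) + j (a • y)
        rw [smul_add, map_add]
      map_smul' := fun c x => by
        ext a
        change j (a • c • x) = j ((a * c) • x)
        rw [mul_smul] }
  have i_apply (x : I) (a : A) : i x a = j (a • x) := rfl
  have hi : Function.Injective i := fun x y hxy => hj (by
    have : i x 1 = i y 1 := by rw [hxy]
    rwa [i_apply, i_apply, one_smul, one_smul] at this)
  obtain ⟨r, hr⟩ := Module.Injective.extension_property A I I (BimodHom ℤ A E) i hi LinearMap.id
  have hr (x : I) : r (i x) = x := congr($hr x)
  let s : BimodHom A N I →ₗ[B] BimodHom ℤ N E :=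
    { toFun := fun φ => of <| AddMonoidHom.toIntLinearMap
        (j.toAddMonoidHom.comp φ.hom.toAddMonoidHom)
      map_add' := fun φ ψ => by
        ext n
        exact map_add j _ _
      map_smul' := fun b φ => rfl }
  have s_apply (φ : BimodHom A N I) (n : N) : s φ n = j (φ n) := rfl
  let ev (ψ : BimodHom ℤ N E) : N →ₗ[A] BimodHom ℤ A E :=
    { toFun := fun n => of
        (ψ.hom ∘ₗ (LinearMap.toSpanSingleton A N n).toAddMonoidHom.toIntLinearMap)
      map_add' := fun x y => by
        ext a
        change ψ (a • (x + y)) = ψ (a • x) + ψ (a • y)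
        rw [smul_add, map_add]
      map_smul' := fun c x => by
        ext a
        change ψ (a • c • x) = ψ ((a * c) • x)
        rw [mul_smul] }
  have ev_apply (ψ : BimodHom ℤ N E) (n : N) (a : A) : ev ψ n a = ψ (a • n) := rfl
  let t : BimodHom ℤ N E →ₗ[B] BimodHom A N I :=
    { toFun := fun ψ => of (r ∘ₗ ev ψ)
      map_add' := fun ψ χ => by
        ext n
        change r (ev (ψ + χ) n) = r (ev ψ n) + r (ev χ n)
        rw [← map_add]
        rfl
      map_smul' := fun b ψ => by
        ext n
        change r (ev (b • ψ) n) = r (ev ψ (op b • n))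
        congr 1
        ext a
        rw [ev_apply, ev_apply, BimodHom.smul_apply, ← smul_comm] }
  have := hasInjectiveDimensionLT_int (E := E) k _ h
  refine (retractOfLinearMap s t fun φ => ?_).hasInjectiveDimensionLT (k + 1)
  ext n
  change r (ev (s φ) n) = φ n
  have : ev (s φ) n = i (φ n) := by
    ext a
    rw [ev_apply, s_apply, i_apply, map_smul]
  rw [this, hr]

end BimodHom

end BimodHom

namespace ZeroMoritaRing

/-! ### The corners of the Morita ring -/

section Presentation

set_option linter.unusedSectionVars false

variable {A B M N : Type u} [Ring A] [Ring B] [AddCommGroup M] [AddCommGroup N]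
  [Module B M] [Module Aᵐᵒᵖ M] [SMulCommClass B Aᵐᵒᵖ M]
  [Module A N] [Module Bᵐᵒᵖ N] [SMulCommClass A Bᵐᵒᵖ N] {L : Type u} [Ring L]

variable (A B M N) in
/-- Exchanging the two diagonal entries. -/
def swap : ZeroMoritaRing A B M N ≃+* ZeroMoritaRing B A N M where
  toFun x := ⟨x.b, x.m, x.n, x.a⟩
  invFun x := ⟨x.b, x.m, x.n, x.a⟩
  left_inv _ := rfl
  right_inv _ := rfl
  map_mul' x y := by ext <;> simp [add_comm]
  map_add' _ _ := rfl

/-- For a ring `L` identified with a Morita ring, the surjection of `L` onto the upper left corner.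
Working with an arbitrary identification `e`, rather than with the Morita ring itself, makes the
two corners interchangeable: replace `e` by `e.trans (swap A B M N)`. -/
def toA (e : L ≃+* ZeroMoritaRing A B M N) : L →+* A := (projA A B M N).comp e.toRingHom

/-- The surjection onto the lower right corner. -/
def toB (e : L ≃+* ZeroMoritaRing A B M N) : L →+* B := (projB A B M N).comp e.toRingHom

variable (e : L ≃+* ZeroMoritaRing A B M N)

theorem toA_apply (x : L) : toA e x = (e x).a := rfl
theorem toB_apply (x : L) : toB e x = (e x).b := rfl

theorem toA_surjective : Function.Surjective (toA e) := fun a =>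
  ⟨e.symm ⟨a, 0, 0, 0⟩, by simp [toA_apply]⟩

theorem toB_surjective : Function.Surjective (toB e) := fun b =>
  ⟨e.symm ⟨0, 0, 0, b⟩, by simp [toB_apply]⟩

theorem ker_mul_ker_mul_ker (x : L) (hx : x ∈ RingHom.ker (toA e)) (y : L)
    (hy : y ∈ RingHom.ker (toB e)) (z : L) (hz : z ∈ RingHom.ker (toA e)) : x * y * z = 0 := by
  rw [RingHom.mem_ker, toA_apply] at hx hz
  rw [RingHom.mem_ker, toB_apply] at hy
  apply e.injective
  ext <;> simp [hx, hy, hz]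

/-! ### Coinduced modules -/

/-- The `L`-module coinduced from the `A`-module `X`: as a tuple,
`(X, Hom_A(N, X))` with the evaluation map `N ⊗ Hom_A(N, X) → X`. -/
def Coind (_ : L ≃+* ZeroMoritaRing A B M N) (X : Type u) [AddCommGroup X] [Module A X] : Type u :=
  X × BimodHom A N X

section

variable (X : Type u) [AddCommGroup X] [Module A X]

instance : AddCommGroup (Coind e X) := inferInstanceAs (AddCommGroup (X × BimodHom A N X))

instance : SMul L (Coind e X) :=
  ⟨fun s x => ((e s).a • x.1 + x.2 (e s).n, (e s).b • x.2)⟩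

variable {X}

theorem Coind.smul_fst (s : L) (x : Coind e X) : (s • x).1 = (e s).a • x.1 + x.2 (e s).n := rfl

theorem Coind.smul_snd (s : L) (x : Coind e X) : (s • x).2 = (e s).b • x.2 := rfl

variable {e} in
@[ext] theorem Coind.ext {x y : Coind e X} (h₁ : x.1 = y.1) (h₂ : x.2 = y.2) : x = y :=
  Prod.ext h₁ h₂

@[simp] theorem Coind.add_fst (x y : Coind e X) : (x + y).1 = x.1 + y.1 := rfl
@[simp] theorem Coind.add_snd (x y : Coind e X) : (x + y).2 = x.2 + y.2 := rfl
@[simp] theorem Coind.zero_fst : (0 : Coind e X).1 = 0 := rfl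
@[simp] theorem Coind.zero_snd : (0 : Coind e X).2 = 0 := rfl

variable (X)

instance : Module L (Coind e X) where
  one_smul x := by ext <;> simp [Coind.smul_fst, Coind.smul_snd]
  mul_smul s t x := by
    ext
    · simp [Coind.smul_fst, Coind.smul_snd, mul_smul, add_assoc]
    · simp [Coind.smul_snd, mul_smul]
  smul_zero s := by ext <;> simp [Coind.smul_fst, Coind.smul_snd]
  smul_add s x y := by
    ext
    · simp only [Coind.smul_fst, Coind.add_fst, Coind.add_snd, smul_add, BimodHom.add_apply]
      abel
    · simp [Coind.smul_snd]
  add_smul s t x := by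
    ext
    · simp only [Coind.smul_fst, Coind.add_fst, map_add, add_a, add_n, add_smul]
      abel
    · simp [Coind.smul_snd, add_smul]
  zero_smul x := by ext <;> simp [Coind.smul_fst, Coind.smul_snd]

/-- Coinduction preserves injectives. For a left ideal `I` of `L` and `g : I → Coind e X`, the first
component of `g` on the first row of `I` is an `A`-linear map from a submodule of `A × N` to `X`.
An extension of it to `A × N` is an element of `Coind e X`, and it induces an extension of `g`. -/
theorem Coind.injective [Module.Injective A X] : Module.Injective L (Coind e X) := by
  refine Module.Baer.injective fun I g => ?_
  -- the matrix with first row `x` and second row zero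
  let row (x : A × N) : L := e.symm ⟨x.1, x.2, 0, 0⟩
  have row_add (x y : A × N) : row (x + y) = row x + row y := by
    apply e.injective
    ext <;> simp [row]
  have row_smul (a : A) (x : A × N) : row (a • x) = e.symm ⟨a, 0, 0, 0⟩ * row x := by
    apply e.injective
    ext <;> simp [row]
  let D : Submodule A (A × N) :=
    { carrier := {x | row x ∈ I}
      zero_mem' := by
        have : row 0 = 0 := by apply e.injective; ext <;> simp [row]
        simp [this]
      add_mem' := fun {x y} hx hy => by
        rw [Set.mem_ofPred_eq, row_add]
        exact I.add_mem hx hy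
      smul_mem' := fun a x hx => by
        rw [Set.mem_ofPred_eq, row_smul]
        exact I.mul_mem_left _ hx }
  let f : D →ₗ[A] X :=
    { toFun := fun x => (g ⟨row x, x.2⟩).1
      map_add' := fun x y => by
        rw [← Coind.add_fst, ← map_add]
        congr 2
        exact Subtype.ext (row_add x y)
      map_smul' := fun a x => by
        have : (⟨row (a • x : D), (a • x).2⟩ : I) = e.symm ⟨a, 0, 0, 0⟩ • ⟨row x, x.2⟩ :=
          Subtype.ext (row_smul a x)
        rw [this, map_smul, Coind.smul_fst]
        simp }
  obtain ⟨F, hF⟩ := Module.Injective.extension_property A X D (A × N) D.subtype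
    D.subtype_injective f
  have hF (x : A × N) (hx : row x ∈ I) : F x = (g ⟨row x, hx⟩).1 := congr($hF ⟨x, hx⟩)
  let h : Coind e X := (F (1, 0), BimodHom.of (F ∘ₗ LinearMap.inr A A N))
  have hF' (a : A) (n : N) : a • h.1 + h.2 n = F (a, n) := by
    change a • F (1, 0) + F (0, n) = _
    rw [← map_smul, ← map_add]
    simp
  refine ⟨LinearMap.toSpanSingleton L _ h, fun s hs => ?_⟩
  rw [LinearMap.toSpanSingleton_apply]
  ext n
  · have hrow : row ((e s).a, (e s).n) = e.symm ⟨1, 0, 0, 0⟩ * s := by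
      apply e.injective
      ext <;> simp [row]
    have hI : row ((e s).a, (e s).n) ∈ I := by rw [hrow]; exact I.mul_mem_left _ hs
    have : (⟨row ((e s).a, (e s).n), hI⟩ : I) = e.symm ⟨1, 0, 0, 0⟩ • ⟨s, hs⟩ := Subtype.ext hrow
    rw [Coind.smul_fst, hF', hF _ hI, this, map_smul, Coind.smul_fst]
    simp
  · have hrow : row (0, op (e s).b • n) = e.symm ⟨0, n, 0, 0⟩ * s := by
      apply e.injective
      ext <;> simp [row]
    have hI : row (0, op (e s).b • n) ∈ I := by rw [hrow]; exact I.mul_mem_left _ hs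
    have : (⟨row (0, op (e s).b • n), hI⟩ : I) = e.symm ⟨0, n, 0, 0⟩ • ⟨s, hs⟩ := Subtype.ext hrow
    rw [Coind.smul_snd, BimodHom.smul_apply]
    have h₁ := hF' 0 (op (e s).b • n)
    rw [zero_smul, zero_add] at h₁
    rw [h₁, hF _ hI, this, map_smul, Coind.smul_fst]
    simp

end

/-- The exact sequence `0 → Z_A X → Coind X → Z_B Hom_A(N, X) → 0`. -/
noncomputable abbrev coindShortComplex (X : ModuleCat.{u} A) : ShortComplex (ModuleCat.{u} L) :=
  ModuleCat.shortComplexOfCompEqZero (M := (ModuleCat.restrictScalars (toA e)).obj X)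
    (N := Coind e X)
    (L := (ModuleCat.restrictScalars (toB e)).obj (ModuleCat.of B (BimodHom A N X)))
    { toFun := fun x => ((x : X), 0)
      map_add' := fun _ _ => Coind.ext rfl (add_zero (0 : BimodHom A N X)).symm
      map_smul' := fun s x => Coind.ext (add_zero ((e s).a • (x : X))).symm
        (smul_zero (A := BimodHom A N X) (e s).b).symm }
    { toFun := fun x => x.2
      map_add' := fun _ _ => rfl
      map_smul' := fun _ _ => rfl }
    rfl

theorem coindShortComplex_shortExact (X : ModuleCat.{u} A) :
    (coindShortComplex e X).ShortExact := by
  refine ModuleCat.shortComplex_shortExact (R := L) _ (fun x => ⟨fun hx => ?_, ?_⟩)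
    (fun x y h => ?_) fun φ => ?_
  · exact ⟨(show Coind e X from x).1, Coind.ext (e := e) (X := X) rfl (Eq.symm hx)⟩
  · rintro ⟨y, rfl⟩
    rfl
  · exact congrArg (fun z : Coind e X => z.1) h
  · exact ⟨((0, φ) : X × BimodHom A N X), rfl⟩

/-! ### The projective module of the second column -/

/-- The second column of the Morita ring as a left `L`-module: as a tuple, `(N, B)`. -/
def Column (_ : L ≃+* ZeroMoritaRing A B M N) : Type u := N × B

instance : AddCommGroup (Column e) := inferInstanceAs (AddCommGroup (N × B))

instance : SMul L (Column e) :=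
  ⟨fun s x => ((e s).a • x.1 + op x.2 • (e s).n, (e s).b * x.2)⟩

theorem Column.smul_fst (s : L) (x : Column e) :
    (s • x).1 = (e s).a • x.1 + op x.2 • (e s).n := rfl

theorem Column.smul_snd (s : L) (x : Column e) : (s • x).2 = (e s).b * x.2 := rfl

variable {e} in
@[ext] theorem Column.ext {x y : Column e} (h₁ : x.1 = y.1) (h₂ : x.2 = y.2) : x = y :=
  Prod.ext h₁ h₂

@[simp] theorem Column.add_fst (x y : Column e) : (x + y).1 = x.1 + y.1 := rfl
@[simp] theorem Column.add_snd (x y : Column e) : (x + y).2 = x.2 + y.2 := rfl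
@[simp] theorem Column.zero_fst : (0 : Column e).1 = 0 := rfl
@[simp] theorem Column.zero_snd : (0 : Column e).2 = 0 := rfl

instance : Module L (Column e) where
  one_smul x := by ext <;> simp [Column.smul_fst, Column.smul_snd]
  mul_smul s t x := by
    ext <;> simp [Column.smul_fst, Column.smul_snd, mul_smul, add_assoc, mul_assoc, smul_comm]
  smul_zero s := by ext <;> simp [Column.smul_fst, Column.smul_snd]
  smul_add s x y := by
    ext
    · simp only [Column.smul_fst, Column.add_fst, Column.add_snd, smul_add]
      rw [show op (x.2 + y.2) • (e s).n = op x.2 • (e s).n + op y.2 • (e s).n by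
        rw [MulOpposite.op_add, add_smul]]
      abel
    · simp [Column.smul_snd, mul_add]
  add_smul s t x := by
    ext
    · simp only [Column.smul_fst, Column.add_fst, map_add, add_a, add_n, add_smul, smul_add]
      abel
    · simp [Column.smul_snd, add_mul]
  zero_smul x := by ext <;> simp [Column.smul_fst, Column.smul_snd]

theorem Column.smul_zero_snd (s : L) (n : N) :
    s • (show Column e from (n, 0)) = ((e s).a • n, 0) := by
  have h : (e s).a • n + op (0 : B) • (e s).n = (e s).a • n := by simp
  exact Column.ext h (mul_zero (e s).b)

/-- The inclusion of the second column. -/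
def Column.toRing : Column e →ₗ[L] L where
  toFun x := e.symm ⟨0, x.1, 0, x.2⟩
  map_add' x y := by apply e.injective; ext <;> simp
  map_smul' s x := by
    apply e.injective
    ext <;> simp [Column.smul_fst, Column.smul_snd]

/-- The projection to the second column. -/
def Column.ofRing : L →ₗ[L] Column e where
  toFun x := ((e x).n, (e x).b)
  map_add' x y := congrArg (fun z => ((z.n, z.b) : N × B)) (map_add e x y)
  map_smul' s x := congrArg (fun z => ((z.n, z.b) : N × B)) (map_mul e s x)

theorem Column.toRing_apply (x : Column e) : Column.toRing e x = e.symm ⟨0, x.1, 0, x.2⟩ := rfl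
theorem Column.ofRing_fst (x : L) : (Column.ofRing e x).1 = (e x).n := rfl
theorem Column.ofRing_snd (x : L) : (Column.ofRing e x).2 = (e x).b := rfl

theorem Column.ofRing_toRing (x : Column e) : Column.ofRing e (Column.toRing e x) = x := by
  ext <;> simp [Column.ofRing_fst, Column.ofRing_snd, Column.toRing_apply]

instance : Module.Finite L (Column e) :=
  Module.Finite.of_surjective (Column.ofRing e) fun x => ⟨_, Column.ofRing_toRing e x⟩

instance : Projective (ModuleCat.of L (Column e)) :=
  (IsProjective.iff_projective (Column e)).1
    (Module.Projective.of_split (Column.toRing e) (Column.ofRing e)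
      (LinearMap.ext (Column.ofRing_toRing e)))

/-- The exact sequence `0 → Z_A N → Column → Z_B B → 0`. -/
noncomputable abbrev columnShortComplex : ShortComplex (ModuleCat.{u} L) :=
  ModuleCat.shortComplexOfCompEqZero
    (M := (ModuleCat.restrictScalars (toA e)).obj (ModuleCat.of A N)) (N := Column e)
    (L := (ModuleCat.restrictScalars (toB e)).obj (ModuleCat.of B B))
    { toFun := fun x => ((x : N), 0)
      map_add' := fun _ _ => Column.ext rfl (add_zero (0 : B)).symm
      map_smul' := fun s x => (Column.smul_zero_snd e s x).symm }
    { toFun := fun x => x.2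
      map_add' := fun _ _ => rfl
      map_smul' := fun _ _ => rfl }
    rfl

theorem columnShortComplex_shortExact : (columnShortComplex e).ShortExact := by
  refine ModuleCat.shortComplex_shortExact (R := L) _ (fun x => ⟨fun hx => ?_, ?_⟩)
    (fun x y h => ?_) fun b => ?_
  · exact ⟨(show Column e from x).1, Column.ext (e := e) rfl (Eq.symm hx)⟩
  · rintro ⟨y, rfl⟩
    rfl
  · exact congrArg (fun z : Column e => z.1) h
  · exact ⟨((0, b) : N × B), rfl⟩

theorem Column.ofRing_swap_toRing (x : Column e) :
    Column.ofRing (e.trans (swap A B M N)) (Column.toRing e x) = 0 := by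
  have h : e (Column.toRing e x) = ⟨0, x.1, 0, x.2⟩ := e.apply_symm_apply _
  exact Column.ext (congrArg (fun z => z.m) h) (congrArg (fun z => z.a) h)

/-- The regular module is an extension of one column by the other. -/
theorem shortExact_column_column :
    (ModuleCat.shortComplexOfCompEqZero (Column.toRing e)
      (Column.ofRing (e.trans (swap A B M N)))
      (LinearMap.ext (Column.ofRing_swap_toRing e))).ShortExact := by
  refine ModuleCat.shortComplex_shortExact (R := L) _ (fun x => ⟨fun hx => ?_, ?_⟩)
    (fun x y h => ?_) fun b => ⟨_, Column.ofRing_toRing _ b⟩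
  · refine ⟨((e x).n, (e x).b), e.injective ?_⟩
    have h₁ : (e x).m = 0 := congrArg (fun z : Column (e.trans (swap A B M N)) => z.1) hx
    have h₂ : (e x).a = 0 := congrArg (fun z : Column (e.trans (swap A B M N)) => z.2) hx
    change e (e.symm ⟨0, (e x).n, 0, (e x).b⟩) = e x
    ext <;> simp [h₁, h₂]
  · rintro ⟨y, rfl⟩
    exact Column.ofRing_swap_toRing e y
  · rw [← Column.ofRing_toRing e x, ← Column.ofRing_toRing e y]
    exact congrArg _ h

end Presentation

end ZeroMoritaRing

/-! ### Finiteness over the corners -/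

section Descent

variable {R : Type w} [CommRing R] {L A B : Type u} [Ring L] [Ring A] [Ring B] [Algebra R L]

theorem exists_algebra_of_surjective (p : L →+* A) (hp : Function.Surjective p)
    [Module.Finite R L] :
    ∃ _ : Algebra R A, Module.Finite R A ∧ ∀ r, algebraMap R A r = p (algebraMap R L r) := by
  let _ : Algebra R A := (p.comp (algebraMap R L)).toAlgebra' fun r x => by
    obtain ⟨y, rfl⟩ := hp x
    rw [RingHom.comp_apply, ← map_mul, ← map_mul, Algebra.commutes]
  let f : L →ₗ[R] A :=
    { p.toAddMonoidHom with
      map_smul' := fun r x => by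
        rw [RingHom.id_apply, Algebra.smul_def, Algebra.smul_def]
        exact map_mul p _ _ }
  exact ⟨inferInstance, Module.Finite.of_surjective f hp, fun r => rfl⟩

/-- Evaluation at finitely many generators of `N` embeds `Hom_A(N, X)` into a power of `X`. The
embedding is `R`-linear if `R` acts on `N` through `A` in the same way as through `B`. -/
theorem BimodHom.finite [IsArtinianRing R] [Algebra R A] [Algebra R B] [Module.Finite R A]
    {N X : Type u} [AddCommGroup N] [Module A N] [Module Bᵐᵒᵖ N] [SMulCommClass A Bᵐᵒᵖ N]
    [AddCommGroup X] [Module A X] [Module.Finite A N] [Module.Finite A X]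
    (h : ∀ (r : R) (n : N), algebraMap R A r • n = op (algebraMap R B r) • n) :
    Module.Finite B (BimodHom A N X) := by
  let _ : Module R X := Module.compHom X (algebraMap R A)
  have : IsScalarTower R A X := ⟨fun r s x => by rw [Algebra.smul_def, mul_smul]; rfl⟩
  let _ : Module R (BimodHom A N X) := Module.compHom _ (algebraMap R B)
  have : IsScalarTower R B (BimodHom A N X) :=
    ⟨fun r s x => by rw [Algebra.smul_def, mul_smul]; rfl⟩
  have : Module.Finite R X := Module.Finite.trans A X
  obtain ⟨k, n, hn⟩ := Module.Finite.exists_fin (R := A) (M := N)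
  let f : BimodHom A N X →ₗ[R] (Fin k → X) :=
    { toFun := fun φ i => φ (n i)
      map_add' := fun φ ψ => rfl
      map_smul' := fun r φ => by
        ext i
        change φ (op (algebraMap R B r) • n i) = algebraMap R A r • φ (n i)
        rw [← h, map_smul] }
  have hf : Function.Injective f := fun φ ψ hφ => by
    have : φ.hom = ψ.hom := by
      refine LinearMap.ext_on hn ?_
      rintro _ ⟨i, rfl⟩
      exact congrFun hφ i
    exact BimodHom.ext fun n => congr($this n)
  have : Module.Finite R (BimodHom A N X) := Module.Finite.of_injective f hf
  exact Module.Finite.of_restrictScalars_finite R B _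

theorem finite_of_restrictScalars (p : L →+* A) (hp : Function.Surjective p) (X : ModuleCat.{u} A)
    (h : Module.Finite L ((ModuleCat.restrictScalars p).obj X)) : Module.Finite A X := by
  have : RingHomSurjective p := ⟨hp⟩
  let f : (ModuleCat.restrictScalars p).obj X →ₛₗ[p] X :=
    { AddMonoidHom.id X with map_smul' := fun x w => rfl }
  exact Module.Finite.of_surjective f Function.surjective_id

theorem IsHomologicalEmbedding.subsingleton_ext {S T : Type u} [Ring S] [Ring T] (p : S →+* T)
    (h : IsHomologicalEmbedding (ModuleCat.restrictScalars.{u} p)) (X Y : ModuleCat.{u} T)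
    (hX : Module.Finite T X) (hY : Module.Finite T Y) (n : ℕ) [Subsingleton (Ext X Y n)] :
    Subsingleton (Ext ((ModuleCat.restrictScalars p).obj X)
      ((ModuleCat.restrictScalars p).obj Y) n) :=
  (h X Y hX hY n).2.subsingleton

end Descent

/-! ### The invariants silp and spli -/

section Dimension

theorem subsingleton_ext_of_iso_left {S : Type u} [Ring S] {X Y W : ModuleCat.{u} S} (i : X ≅ Y)
    {n : ℕ} (h : Subsingleton (Ext X W n)) : Subsingleton (Ext Y W n) := by
  refine subsingleton_of_forall_eq 0 fun x => ?_
  rw [← Ext.mk₀_id_comp x, ← i.inv_hom_id, ← Ext.mk₀_comp_mk₀_assoc,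
    Subsingleton.elim ((Ext.mk₀ i.hom).comp x (zero_add n)) 0, Ext.comp_zero]

theorem subsingleton_ext_of_iso_right {S : Type u} [Ring S] {X Y W : ModuleCat.{u} S} (i : X ≅ Y)
    {n : ℕ} (h : Subsingleton (Ext W X n)) : Subsingleton (Ext W Y n) := by
  refine subsingleton_of_forall_eq 0 fun x => ?_
  rw [← Ext.comp_mk₀_id x, ← i.inv_hom_id, ← Ext.mk₀_comp_mk₀,
    ← Ext.comp_assoc_of_second_deg_zero,
    Subsingleton.elim (x.comp (Ext.mk₀ i.inv) (add_zero n)) 0, Ext.zero_comp]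

theorem subsingleton_ext_X₂_left {S : Type u} [Ring S] {C : ShortComplex (ModuleCat.{u} S)}
    (hC : C.ShortExact) {W : ModuleCat.{u} S} {n : ℕ} (h₁ : Subsingleton (Ext C.X₁ W n))
    (h₃ : Subsingleton (Ext C.X₃ W n)) : Subsingleton (Ext C.X₂ W n) := by
  refine subsingleton_of_forall_eq 0 fun x => ?_
  obtain ⟨y, rfl⟩ := Ext.contravariant_sequence_exact₂ hC W x (Subsingleton.elim _ _)
  rw [Subsingleton.elim y 0, Ext.comp_zero]

theorem subsingleton_ext_X₂_right {S : Type u} [Ring S] {C : ShortComplex (ModuleCat.{u} S)}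
    (hC : C.ShortExact) {W : ModuleCat.{u} S} {n : ℕ} (h₁ : Subsingleton (Ext W C.X₁ n))
    (h₃ : Subsingleton (Ext W C.X₃ n)) : Subsingleton (Ext W C.X₂ n) := by
  refine subsingleton_of_forall_eq 0 fun x => ?_
  obtain ⟨y, rfl⟩ := Ext.covariant_sequence_exact₂ W hC x (Subsingleton.elim _ _)
  rw [Subsingleton.elim y 0, Ext.zero_comp]

theorem exists_nat_of_lt_top {x : WithBot ℕ∞} (hx : x < ⊤) : ∃ n : ℕ, x ≤ n := by
  induction x with
  | bot => exact ⟨0, bot_le⟩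
  | coe x =>
    induction x with
    | top => exact absurd hx (lt_irrefl _)
    | coe n => exact ⟨n, le_rfl⟩

theorem natCast_lt_top_withBot (n : ℕ) : (n : WithBot ℕ∞) < ⊤ :=
  WithBot.coe_lt_coe.2 (ENat.natCast_lt_top n)

variable {S : Type u} [Ring S]

theorem silp_lt_top_iff : silp S < ⊤ ↔
    ∃ s, ∀ F : ModuleCat.{u} S, Module.Finite S F → Projective F →
      HasInjectiveDimensionLT F (s + 1) := by
  constructor
  · intro h
    obtain ⟨s, hs⟩ := exists_nat_of_lt_top h
    exact ⟨s, fun F h₁ h₂ => (injectiveDimension_le_iff F s).1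
      ((le_iSup₂_of_le F h₁ (le_iSup (fun _ : Projective F => injectiveDimension F) h₂)).trans hs)⟩
  · rintro ⟨s, hs⟩
    exact (iSup_le fun F => iSup_le fun h₁ => iSup_le fun h₂ =>
      (injectiveDimension_le_iff F s).2 (hs F h₁ h₂)).trans_lt (natCast_lt_top_withBot s)

theorem spli_lt_top_iff : spli S < ⊤ ↔
    ∃ s, ∀ I : ModuleCat.{u} S, Module.Finite S I → Injective I →
      HasProjectiveDimensionLT I (s + 1) := by
  constructor
  · intro h
    obtain ⟨s, hs⟩ := exists_nat_of_lt_top h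
    exact ⟨s, fun I h₁ h₂ => (projectiveDimension_le_iff I s).1
      ((le_iSup₂_of_le I h₁ (le_iSup (fun _ : Injective I => projectiveDimension I) h₂)).trans hs)⟩
  · rintro ⟨s, hs⟩
    exact (iSup_le fun I => iSup_le fun h₁ => iSup_le fun h₂ =>
      (projectiveDimension_le_iff I s).2 (hs I h₁ h₂)).trans_lt (natCast_lt_top_withBot s)

/-- Finitely generated modules of finite projective dimension have injective dimension bounded by
that of the finitely generated projectives. -/
theorem hasInjectiveDimensionLT_of_projectiveDimension [IsNoetherianRing S] {s : ℕ}
    (hs : ∀ F : ModuleCat.{u} S, Module.Finite S F → Projective F → HasInjectiveDimensionLT F s)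
    (k : ℕ) (X : ModuleCat.{u} S) (hX : Module.Finite S X)
    (h : HasProjectiveDimensionLT X (k + 1)) : HasInjectiveDimensionLT X s :=
  finite_projectiveDimension_induction (P := fun _ X => HasInjectiveDimensionLT X s) hs
    (fun _ C hC h₂ hP _ => hC.hasInjectiveDimensionLT_X₃ s (hs C.X₂ h₂ hP) inferInstance) k X hX h

/-- Finitely generated modules of finite injective dimension have projective dimension bounded by
that of the finitely generated injectives. -/
theorem hasProjectiveDimensionLT_of_injectiveDimension (hS : EnoughFiniteInjectives S) {s : ℕ}
    (hs : ∀ I : ModuleCat.{u} S, Module.Finite S I → Injective I → HasProjectiveDimensionLT I s)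
    (k : ℕ) (X : ModuleCat.{u} S) (hX : Module.Finite S X)
    (h : HasInjectiveDimensionLT X (k + 1)) : HasProjectiveDimensionLT X s :=
  finite_injectiveDimension_induction hS (P := fun _ X => HasProjectiveDimensionLT X s) hs
    (fun _ C hC h₂ hI _ => hC.hasProjectiveDimensionLT_X₁ s (hs C.X₂ h₂ hI) inferInstance) k X hX h

/-- Horseshoe lemma for embeddings into injective modules of projective dimension `< c`. -/
theorem exists_mono_injective_X₂ {c : ℕ} {C : ShortComplex (ModuleCat.{u} S)} (hC : C.ShortExact)
    (h₁ : ∃ (J : ModuleCat.{u} S) (i : C.X₁ ⟶ J), Injective J ∧ HasProjectiveDimensionLT J c ∧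
      Mono i)
    (h₃ : ∃ (J : ModuleCat.{u} S) (i : C.X₃ ⟶ J), Injective J ∧ HasProjectiveDimensionLT J c ∧
      Mono i) :
    ∃ (J : ModuleCat.{u} S) (i : C.X₂ ⟶ J), Injective J ∧ HasProjectiveDimensionLT J c ∧
      Mono i := by
  obtain ⟨J, i, _, _, _⟩ := h₁
  obtain ⟨J', i', _, _, _⟩ := h₃
  have := hC.mono_f
  refine ⟨J ⊞ J', Limits.biprod.lift (Injective.factorThru i C.f) (C.g ≫ i'), inferInstance,
    inferInstance, Preadditive.mono_of_cancel_zero _ fun x hx => ?_⟩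
  have hg : x ≫ C.g = 0 := by
    rw [← cancel_mono i', Category.assoc]
    simpa using hx =≫ Limits.biprod.snd
  have hf : x ≫ Injective.factorThru i C.f = 0 := by simpa using hx =≫ Limits.biprod.fst
  rw [← hC.exact.lift_f x hg, Category.assoc, Injective.comp_factorThru,
    ← Limits.zero_comp (f := i), cancel_mono] at hf
  rw [← hC.exact.lift_f x hg, hf, Limits.zero_comp]

end Dimension

namespace ZeroMoritaRing

variable {A B M N : Type u} [Ring A] [Ring B] [AddCommGroup M] [AddCommGroup N]
  [Module B M] [Module Aᵐᵒᵖ M] [SMulCommClass B Aᵐᵒᵖ M]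
  [Module A N] [Module Bᵐᵒᵖ N] [SMulCommClass A Bᵐᵒᵖ N] {L : Type u} [Ring L]

set_option linter.unusedSectionVars false

/-! ### Dimensions of modules over the Morita ring -/

theorem finite_N (e : L ≃+* ZeroMoritaRing A B M N)
    [IsNoetherianRing L] : Module.Finite A N := by
  refine finite_of_restrictScalars (toA e) (toA_surjective e) (ModuleCat.of A N) ?_
  have := (columnShortComplex_shortExact e).mono_f
  have : Module.Finite L (columnShortComplex e).X₂ := inferInstanceAs (Module.Finite L (Column e))
  exact Module.Finite.of_injective (columnShortComplex e).f.hom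
    ((ModuleCat.mono_iff_injective _).1 inferInstance)

theorem finite_bimodHom (e : L ≃+* ZeroMoritaRing A B M N)
    (R : Type w) [CommRing R] [IsArtinianRing R] [Algebra R L]
    [Module.Finite R L] (X : Type u) [AddCommGroup X] [Module A X] [Module.Finite A X] :
    Module.Finite B (BimodHom A N X) := by
  have : IsNoetherianRing L := isNoetherian_of_tower R inferInstance
  have := finite_N e
  obtain ⟨_, _, hA⟩ := exists_algebra_of_surjective (R := R) (toA e) (toA_surjective e)
  obtain ⟨_, _, hB⟩ := exists_algebra_of_surjective (R := R) (toB e) (toB_surjective e)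
  refine BimodHom.finite (R := R) fun r n => ?_
  rw [hA, hB, toA_apply, toB_apply]
  -- compare the entries of the commuting products with the matrix unit entry `n`
  have := congrArg (fun x => (e x).n) (Algebra.commutes r (e.symm ⟨0, n, 0, 0⟩))
  simpa using this

theorem isNoetherianRing_A (e : L ≃+* ZeroMoritaRing A B M N)
    [IsNoetherianRing L] : IsNoetherianRing A :=
  isNoetherianRing_of_surjective L A (toA e) (toA_surjective e)

theorem enoughFiniteInjectives_A (e : L ≃+* ZeroMoritaRing A B M N)
    (R : Type w) [CommRing R] [IsArtinianRing R] [Algebra R L]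
    [Module.Finite R L] : EnoughFiniteInjectives A := by
  obtain ⟨_, _, -⟩ := exists_algebra_of_surjective (R := R) (toA e) (toA_surjective e)
  exact enoughFiniteInjectives R A

/-- If `N_B` is projective, then `Z_A I` has injective dimension at most one for `I` finitely
generated injective. On modules `Z_A X` this is tested by the homological embedding `Z_A`; on
modules `Z_B Y`, the sequence `0 → Z_A I → Coind I → Z_B Hom_A(N, I) → 0` gives `Ext²(Z_B Y, Z_A I)
= Ext¹(Z_B Y, Z_B Hom_A(N, I)) = Ext¹(Y, Hom_A(N, I)) = 0`. -/
theorem hasInjectiveDimensionLT_two_of_injective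
    (e : L ≃+* ZeroMoritaRing A B M N)
    (hA : IsHomologicalEmbedding (ModuleCat.restrictScalars.{u} (toA e)))
    (hB : IsHomologicalEmbedding (ModuleCat.restrictScalars.{u} (toB e)))
    [Module.Projective Bᵐᵒᵖ N]
    (R : Type w) [CommRing R] [IsArtinianRing R] [Algebra R L] [Module.Finite R L]
    (I : ModuleCat.{u} A) (hI : Module.Finite A I) (hInj : Injective I) :
    HasInjectiveDimensionLT ((ModuleCat.restrictScalars (toA e)).obj I) 2 := by
  have : IsNoetherianRing L := isNoetherian_of_tower R inferInstance
  have : Module.Injective A I := (Module.injective_iff_injective_object A I).2 hInj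
  refine hasInjectiveDimensionLT_two_of_finite _ fun V _ => ?_
  refine finite_restrictScalars_induction (toA e) (toB e) (toA_surjective e) (toB_surjective e)
    (ker_mul_ker_mul_ker e)
    (P := fun V => Subsingleton (Ext V ((ModuleCat.restrictScalars (toA e)).obj I) 2))
    (fun i => subsingleton_ext_of_iso_left i) (fun C hC => subsingleton_ext_X₂_left hC)
    (fun X hX => ?_) (fun Y hY => ?_) V
  · have := HasInjectiveDimensionLT.subsingleton I 1 2 (by simp) X
    exact hA.subsingleton_ext _ X I hX hI 2
  · have hH : Injective (ModuleCat.of B (BimodHom A N I)) :=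
      injective_iff_hasInjectiveDimensionLT_one.2 (BimodHom.hasInjectiveDimensionLT 0
        (projective_iff_hasProjectiveDimensionLT_one.1 ((IsProjective.iff_projective N).1 ‹_›)))
    have := HasInjectiveDimensionLT.subsingleton (ModuleCat.of B (BimodHom A N I)) 1 1 le_rfl Y
    have := hB.subsingleton_ext _ Y (ModuleCat.of B (BimodHom A N I)) hY
      (finite_bimodHom e R I) 1
    have hJ : Injective (coindShortComplex e I).X₂ :=
      (Module.injective_iff_injective_object L (Coind e I)).1 (Coind.injective e I)
    refine subsingleton_of_forall_eq 0 fun x => ?_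
    obtain ⟨y, rfl⟩ := Ext.covariant_sequence_exact₁ _ (coindShortComplex_shortExact e I) x
      (Ext.eq_zero_of_injective _) (n₀ := 1) rfl
    rw [Subsingleton.elim y 0, Ext.zero_comp]

theorem hasInjectiveDimensionLT_restrictScalars
    (e : L ≃+* ZeroMoritaRing A B M N)
    (hA : IsHomologicalEmbedding (ModuleCat.restrictScalars.{u} (toA e)))
    (hB : IsHomologicalEmbedding (ModuleCat.restrictScalars.{u} (toB e)))
    [Module.Projective Bᵐᵒᵖ N]
    (R : Type w) [CommRing R] [IsArtinianRing R] [Algebra R L] [Module.Finite R L]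
    (k : ℕ) (X : ModuleCat.{u} A) (hX : Module.Finite A X)
    (h : HasInjectiveDimensionLT X (k + 1)) :
    HasInjectiveDimensionLT ((ModuleCat.restrictScalars (toA e)).obj X) (k + 2) := by
  refine finite_injectiveDimension_induction (enoughFiniteInjectives_A e R)
    (P := fun k X => HasInjectiveDimensionLT ((ModuleCat.restrictScalars (toA e)).obj X) (k + 1))
    (hasInjectiveDimensionLT_two_of_injective e hA hB R) (fun k C hC h₂ hI ih => ?_) k X hX h
  have : HasInjectiveDimensionLT (C.map (ModuleCat.restrictScalars (toA e))).X₂ 2 :=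
    hasInjectiveDimensionLT_two_of_injective e hA hB R C.X₂ h₂ hI
  exact (hC.map_of_exact (ModuleCat.restrictScalars (toA e))).hasInjectiveDimensionLT_X₁ (k + 2)
    ih (hasInjectiveDimensionLT_of_ge _ 2 _ (by simp))

/-- If `_A N` is projective, then `Z_B F` has projective dimension at most one for `F` finitely
generated projective. It suffices to treat `F = B`. On modules `Z_B Y` this is tested by the
homological embedding `Z_B`; on modules `Z_A X`, the sequence `0 → Z_A N → Column → Z_B B → 0` gives
`Ext²(Z_B B, Z_A X) = Ext¹(Z_A N, Z_A X) = Ext¹(N, X) = 0`. -/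
theorem hasProjectiveDimensionLT_two_of_projective
    (e : L ≃+* ZeroMoritaRing A B M N)
    (hA : IsHomologicalEmbedding (ModuleCat.restrictScalars.{u} (toA e)))
    (hB : IsHomologicalEmbedding (ModuleCat.restrictScalars.{u} (toB e)))
    [Module.Projective A N]
    (R : Type w) [CommRing R] [IsArtinianRing R] [Algebra R L] [Module.Finite R L]
    (F : ModuleCat.{u} B) (hF : Module.Finite B F) (hP : Projective F) :
    HasProjectiveDimensionLT ((ModuleCat.restrictScalars (toB e)).obj F) 2 := by
  have : IsNoetherianRing L := isNoetherian_of_tower R inferInstance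
  have hC := columnShortComplex_shortExact e
  refine finite_projective_induction
    (P := fun F => HasProjectiveDimensionLT ((ModuleCat.restrictScalars (toB e)).obj F) 2)
    (fun r _ => (r.map (ModuleCat.restrictScalars (toB e))).hasProjectiveDimensionLT 2)
    (fun C hC => (hC.map_of_exact (ModuleCat.restrictScalars (toB e))).hasProjectiveDimensionLT_X₂
      2) ?_ F
  have : Module.Finite L ((ModuleCat.restrictScalars (toB e)).obj (ModuleCat.of B B)) := by
    have := hC.epi_g
    have : Module.Finite L (columnShortComplex e).X₂ :=
      inferInstanceAs (Module.Finite L (Column e))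
    exact Module.Finite.of_surjective (columnShortComplex e).g.hom
      ((ModuleCat.epi_iff_surjective _).1 inferInstance)
  have hBB : Module.Finite B (ModuleCat.of B B) := inferInstanceAs (Module.Finite B B)
  have hBP : Projective (ModuleCat.of B B) := (IsProjective.iff_projective B).1 inferInstance
  have hNP : Projective (ModuleCat.of A N) := (IsProjective.iff_projective N).1 ‹_›
  refine hasProjectiveDimensionLT_two_of_finite _ fun V _ => ?_
  refine finite_restrictScalars_induction (toA e) (toB e) (toA_surjective e) (toB_surjective e)
    (ker_mul_ker_mul_ker e)
    (P := fun V =>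
      Subsingleton (Ext ((ModuleCat.restrictScalars (toB e)).obj (ModuleCat.of B B)) V 2))
    (fun i => subsingleton_ext_of_iso_right i) (fun C hC => subsingleton_ext_X₂_right hC)
    (fun X hX => ?_) (fun Y hY => ?_) V
  · have := HasProjectiveDimensionLT.subsingleton (ModuleCat.of A N) 1 1 le_rfl X
    have := hA.subsingleton_ext _ (ModuleCat.of A N) X (finite_N e) hX 1
    have hP : Projective (columnShortComplex e).X₂ :=
      inferInstanceAs (Projective (ModuleCat.of L (Column e)))
    refine subsingleton_of_forall_eq 0 fun x => ?_
    obtain ⟨y, rfl⟩ := Ext.contravariant_sequence_exact₃ hC _ x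
      (Ext.eq_zero_of_projective _) (n₀ := 1) rfl
    rw [Subsingleton.elim y 0, Ext.comp_zero]
  · have := HasProjectiveDimensionLT.subsingleton (ModuleCat.of B B) 1 2 (by simp) Y
    exact hB.subsingleton_ext _ (ModuleCat.of B B) Y hBB hY 2

theorem hasProjectiveDimensionLT_restrictScalars
    (e : L ≃+* ZeroMoritaRing A B M N)
    (hA : IsHomologicalEmbedding (ModuleCat.restrictScalars.{u} (toA e)))
    (hB : IsHomologicalEmbedding (ModuleCat.restrictScalars.{u} (toB e)))
    [Module.Projective A N]
    (R : Type w) [CommRing R] [IsArtinianRing R] [Algebra R L] [Module.Finite R L]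
    (k : ℕ) (Y : ModuleCat.{u} B) (hY : Module.Finite B Y)
    (h : HasProjectiveDimensionLT Y (k + 1)) :
    HasProjectiveDimensionLT ((ModuleCat.restrictScalars (toB e)).obj Y) (k + 2) := by
  have : IsNoetherianRing L := isNoetherian_of_tower R inferInstance
  have : IsNoetherianRing B := isNoetherianRing_A (e.trans (swap A B M N))
  refine finite_projectiveDimension_induction
    (P := fun k Y => HasProjectiveDimensionLT ((ModuleCat.restrictScalars (toB e)).obj Y) (k + 1))
    (hasProjectiveDimensionLT_two_of_projective e hA hB R) (fun k C hC h₂ hP ih => ?_) k Y hY h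
  have : HasProjectiveDimensionLT (C.map (ModuleCat.restrictScalars (toB e))).X₂ 2 :=
    hasProjectiveDimensionLT_two_of_projective e hA hB R C.X₂ h₂ hP
  exact (hC.map_of_exact (ModuleCat.restrictScalars (toB e))).hasProjectiveDimensionLT_X₃ (k + 2)
    ih (hasProjectiveDimensionLT_of_ge _ 2 _ (by simp))

theorem exists_hasInjectiveDimensionLT_column
    (e : L ≃+* ZeroMoritaRing A B M N)
    (hA : IsHomologicalEmbedding (ModuleCat.restrictScalars.{u} (toA e)))
    (hB : IsHomologicalEmbedding (ModuleCat.restrictScalars.{u} (toB e)))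
    [Module.Projective Aᵐᵒᵖ M]
    [Module.Projective Bᵐᵒᵖ N] (R : Type w) [CommRing R] [IsArtinianRing R] [Algebra R L]
    [Module.Finite R L] (hN : projectiveDimension (ModuleCat.of A N) < ⊤) (hsA : silp A < ⊤)
    (hsB : silp B < ⊤) : ∃ c, HasInjectiveDimensionLT (ModuleCat.of L (Column e)) c := by
  have : IsNoetherianRing L := isNoetherian_of_tower R inferInstance
  have := isNoetherianRing_A e
  obtain ⟨s, hs⟩ := silp_lt_top_iff.1 hsA
  obtain ⟨t, ht⟩ := silp_lt_top_iff.1 hsB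
  obtain ⟨k, hk⟩ := (projectiveDimension_ne_top_iff _).1 hN.ne
  have hfN := finite_N e
  have hBP : Projective (ModuleCat.of B B) := (IsProjective.iff_projective B).1 inferInstance
  have hBB : Module.Finite B (ModuleCat.of B B) := inferInstanceAs (Module.Finite B B)
  have h₁ := hasInjectiveDimensionLT_restrictScalars e hA hB R s (ModuleCat.of A N) hfN
    (hasInjectiveDimensionLT_of_projectiveDimension hs k _ hfN hk)
  have h₃ : HasInjectiveDimensionLT
      ((ModuleCat.restrictScalars (toB e)).obj (ModuleCat.of B B)) (t + 2) :=
    hasInjectiveDimensionLT_restrictScalars (e.trans (swap A B M N)) hB hA R t (ModuleCat.of B B)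
      hBB (ht _ hBB hBP)
  exact ⟨max (s + 2) (t + 2), (columnShortComplex_shortExact e).hasInjectiveDimensionLT_X₂ _
    (hasInjectiveDimensionLT_of_ge _ (s + 2) _ (le_max_left _ _))
    (hasInjectiveDimensionLT_of_ge _ (t + 2) _ (le_max_right _ _))⟩

theorem silp_lt_top
    (e : L ≃+* ZeroMoritaRing A B M N)
    (hA : IsHomologicalEmbedding (ModuleCat.restrictScalars.{u} (toA e)))
    (hB : IsHomologicalEmbedding (ModuleCat.restrictScalars.{u} (toB e)))
    [Module.Projective Aᵐᵒᵖ M] [Module.Projective Bᵐᵒᵖ N] (R : Type w) [CommRing R]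
    [IsArtinianRing R] [Algebra R L] [Module.Finite R L]
    (hM : projectiveDimension (ModuleCat.of B M) < ⊤)
    (hN : projectiveDimension (ModuleCat.of A N) < ⊤) (hsA : silp A < ⊤) (hsB : silp B < ⊤) :
    silp L < ⊤ := by
  obtain ⟨c, hc⟩ := exists_hasInjectiveDimensionLT_column e hA hB R hN hsA hsB
  obtain ⟨d, hd⟩ := exists_hasInjectiveDimensionLT_column (e.trans (swap A B M N)) hB hA R hM
    hsB hsA
  refine silp_lt_top_iff.2 ⟨max c d, fun F _ _ => ?_⟩
  have hL : HasInjectiveDimensionLT (ModuleCat.of L L) (max c d) :=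
    (shortExact_column_column e).hasInjectiveDimensionLT_X₂ _
      (hasInjectiveDimensionLT_of_ge _ c _ (le_max_left _ _))
      (hasInjectiveDimensionLT_of_ge _ d _ (le_max_right _ _))
  exact finite_projective_induction (P := fun F => HasInjectiveDimensionLT F (max c d + 1))
    (fun r _ => r.hasInjectiveDimensionLT _) (fun C hC => hC.hasInjectiveDimensionLT_X₂ _)
    (hasInjectiveDimensionLT_of_ge _ _ _ (Nat.le_succ _)) F

theorem exists_hasProjectiveDimensionLT_coind
    (e : L ≃+* ZeroMoritaRing A B M N)
    (hA : IsHomologicalEmbedding (ModuleCat.restrictScalars.{u} (toA e)))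
    (hB : IsHomologicalEmbedding (ModuleCat.restrictScalars.{u} (toB e)))
    [Module.Projective B M] [Module.Projective A N]
    (R : Type w) [CommRing R] [IsArtinianRing R] [Algebra R L] [Module.Finite R L]
    (hN : projectiveDimension (ModuleCat.of Bᵐᵒᵖ N) < ⊤) (hsA : spli A < ⊤) (hsB : spli B < ⊤) :
    ∃ c, ∀ X : ModuleCat.{u} A, Module.Finite A X → Injective X →
      HasProjectiveDimensionLT (ModuleCat.of L (Coind e X)) c := by
  obtain ⟨s, hs⟩ := spli_lt_top_iff.1 hsA
  obtain ⟨t, ht⟩ := spli_lt_top_iff.1 hsB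
  obtain ⟨k, hk⟩ := (projectiveDimension_ne_top_iff _).1 hN.ne
  refine ⟨max (s + 2) (t + 2), fun X hX hI => ?_⟩
  have : Module.Injective A X := (Module.injective_iff_injective_object A X).2 hI
  have hH := finite_bimodHom e R X
  have h₁ : HasProjectiveDimensionLT ((ModuleCat.restrictScalars (toA e)).obj X) (s + 2) :=
    hasProjectiveDimensionLT_restrictScalars (e.trans (swap A B M N)) hB hA R s X hX (hs X hX hI)
  have h₃ := hasProjectiveDimensionLT_restrictScalars e hA hB R t
    (ModuleCat.of B (BimodHom A N X)) hH
    (hasProjectiveDimensionLT_of_injectiveDimension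
      (enoughFiniteInjectives_A (e.trans (swap A B M N)) R) ht k _ hH
      (BimodHom.hasInjectiveDimensionLT k hk))
  exact (coindShortComplex_shortExact e X).hasProjectiveDimensionLT_X₂ _
    (hasProjectiveDimensionLT_of_ge _ (s + 2) _ (le_max_left _ _))
    (hasProjectiveDimensionLT_of_ge _ (t + 2) _ (le_max_right _ _))

/-- Embed `X` into a finitely generated injective `I`, and `Z_A I` into `Coind I`. -/
theorem exists_mono_coind (e : L ≃+* ZeroMoritaRing A B M N)
    {R : Type w} [CommRing R] [IsArtinianRing R] [Algebra R L]
    [Module.Finite R L] {c : ℕ}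
    (hc : ∀ X : ModuleCat.{u} A, Module.Finite A X → Injective X →
      HasProjectiveDimensionLT (ModuleCat.of L (Coind e X)) c)
    (X : ModuleCat.{u} A) (hX : Module.Finite A X) :
    ∃ (J : ModuleCat.{u} L) (i : (ModuleCat.restrictScalars (toA e)).obj X ⟶ J), Injective J ∧
      HasProjectiveDimensionLT J c ∧ Mono i := by
  obtain ⟨I, f, h₁, h₂, h₃⟩ := enoughFiniteInjectives_A e R X hX
  have : Module.Injective A I := (Module.injective_iff_injective_object A I).2 h₂
  have := (coindShortComplex_shortExact e I).mono_f
  exact ⟨ModuleCat.of L (Coind e I),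
    (ModuleCat.restrictScalars (toA e)).map f ≫ (coindShortComplex e I).f,
    (Module.injective_iff_injective_object L (Coind e I)).1 (Coind.injective e I), hc I h₁ h₂,
    mono_comp _ _⟩

theorem spli_lt_top
    (e : L ≃+* ZeroMoritaRing A B M N)
    (hA : IsHomologicalEmbedding (ModuleCat.restrictScalars.{u} (toA e)))
    (hB : IsHomologicalEmbedding (ModuleCat.restrictScalars.{u} (toB e)))
    [Module.Projective B M] [Module.Projective A N]
    (R : Type w) [CommRing R] [IsArtinianRing R] [Algebra R L] [Module.Finite R L]
    (hM : projectiveDimension (ModuleCat.of Aᵐᵒᵖ M) < ⊤)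
    (hN : projectiveDimension (ModuleCat.of Bᵐᵒᵖ N) < ⊤) (hsA : spli A < ⊤) (hsB : spli B < ⊤) :
    spli L < ⊤ := by
  have : IsNoetherianRing L := isNoetherian_of_tower R inferInstance
  obtain ⟨c, hc⟩ := exists_hasProjectiveDimensionLT_coind e hA hB R hN hsA hsB
  obtain ⟨d, hd⟩ := exists_hasProjectiveDimensionLT_coind (e.trans (swap A B M N)) hB hA R hM
    hsB hsA
  have hc' : ∀ X : ModuleCat.{u} A, Module.Finite A X → Injective X →
      HasProjectiveDimensionLT (ModuleCat.of L (Coind e X)) (max c d + 1) := fun X h₁ h₂ =>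
    have := hc X h₁ h₂
    hasProjectiveDimensionLT_of_ge _ c _ (by lia)
  have hd' : ∀ Y : ModuleCat.{u} B, Module.Finite B Y → Injective Y →
      HasProjectiveDimensionLT (ModuleCat.of L (Coind (e.trans (swap A B M N)) Y))
        (max c d + 1) := fun Y h₁ h₂ =>
    have := hd Y h₁ h₂
    hasProjectiveDimensionLT_of_ge _ d _ (by lia)
  refine spli_lt_top_iff.2 ⟨max c d, fun I _ _ => ?_⟩
  obtain ⟨J, i, _, _, _⟩ := finite_restrictScalars_induction (toA e) (toB e) (toA_surjective e)
    (toB_surjective e) (ker_mul_ker_mul_ker e)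
    (P := fun V => ∃ (J : ModuleCat.{u} L) (i : V ⟶ J), Injective J ∧
      HasProjectiveDimensionLT J (max c d + 1) ∧ Mono i)
    (fun f ⟨J, i, h₁, h₂, _⟩ => ⟨J, f.inv ≫ i, h₁, h₂, mono_comp _ _⟩)
    (fun C hC => exists_mono_injective_X₂ hC) (exists_mono_coind (R := R) e hc')
    (exists_mono_coind (R := R) (e.trans (swap A B M N)) hd') I
  exact (Retract.mk i (Injective.factorThru (𝟙 I) i)
    (Injective.comp_factorThru (𝟙 I) i)).hasProjectiveDimensionLT _

end ZeroMoritaRing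

end

theorem theorem4p9 {A B M N : Type u} [Ring A] [Ring B] [AddCommGroup M] [AddCommGroup N]
    -- `M` is a `B`-`A`-bimodule and `N` is an `A`-`B`-bimodule
    [Module B M] [Module Aᵐᵒᵖ M] [SMulCommClass B Aᵐᵒᵖ M]
    [Module A N] [Module Bᵐᵒᵖ N] [SMulCommClass A Bᵐᵒᵖ N]
    -- the Morita ring is an Artin `R`-algebra
    {R : Type w} [CommRing R] [IsArtinianRing R]
    [Algebra R (ZeroMoritaRing A B M N)] [Module.Finite R (ZeroMoritaRing A B M N)]
    (hZA : IsHomologicalEmbedding (ZeroMoritaRing.ZA A B M N))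
    (hZB : IsHomologicalEmbedding (ZeroMoritaRing.ZB A B M N)) :
    (Module.Projective Aᵐᵒᵖ M → projectiveDimension (ModuleCat.of B M) < ⊤ →
      Module.Projective Bᵐᵒᵖ N → projectiveDimension (ModuleCat.of A N) < ⊤ →
      silp A < ⊤ → silp B < ⊤ → silp (ZeroMoritaRing A B M N) < ⊤) ∧
    (Module.Projective B M → projectiveDimension (ModuleCat.of Aᵐᵒᵖ M) < ⊤ →
      Module.Projective A N → projectiveDimension (ModuleCat.of Bᵐᵒᵖ N) < ⊤ →
      spli A < ⊤ → spli B < ⊤ → spli (ZeroMoritaRing A B M N) < ⊤) :=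
  ⟨fun _ hM _ hN => ZeroMoritaRing.silp_lt_top (RingEquiv.refl _) hZA hZB R hM hN,
    fun _ hM _ hN => ZeroMoritaRing.spli_lt_top (RingEquiv.refl _) hZA hZB R hM hN⟩
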